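/- Let $Q=\{(\boldsymbol R_1,\boldsymbol R_2)\in S^2\times S^2:\boldsymbol R_1\neq\pm \boldsymbol R_2\}$, where $S^2\subset\mathbb R^3$ is the unit sphere, let $T^*Q$ carry its canonical Poisson bracket (with $\{x^i,\xi_j\}=\delta^i_j$ in cotangent coordinates), and let $SO(3)$ act on $T^*Q$ by the cotangent lift of the simultaneous rotation of both points. (1) On $P=\mathbb R^3\times(0,\pi)\times\mathbb R\ni(\boldsymbol m,q,p)$, $\boldsymbol m=(m_x,m_y,m_z)$, the formula $$\{F,G\}_P=-\Big(\boldsymbol m,\tfrac{\partial F}{\partial \boldsymbol m}\times\tfrac{\partial G}{\partial \boldsymbol m}\Big)+\tfrac{\partial F}{\partial q}\tfrac{\partial G}{\partial p}-\tfrac{\partial F}{\partial p}\tfrac{\partial G}{\partial q}$$ defines a Poisson bracket, with $\{m_x,m_y\}=-m_z$, $\{m_y,m_z\}=-m_x$, $\{m_z,m_x\}=-m_y$, $\{q,p\}=1$, all other brackets of coordinates being zero, and $|\boldsymbol m|^2$ is a Casimir function. (2) The orbit space $T^*Q/SO(3)$, with the quotient topology, has a smooth manifold structure and a Poisson bracket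 for which the projection $\pi:T^*Q\to T^*Q/SO(3)$ is a smooth submersion and a Poisson map, and there is a Poisson diffeomorphism $\Psi:T^*Q/SO(3)\to P$. It can be chosen as follows. For $\alpha\in T^*_{(\boldsymbol R_1,\boldsymbol R_2)}Q$ write $\Psi(\pi(\alpha))=(\boldsymbol m,q,p)$, and let $(e_x,e_y,e_z)$ be the positively oriented orthonormal frame with $e_z=\boldsymbol R_1$ and $\boldsymbol R_2=\sin q\,e_y+\cos q\,e_z$. Then $q$ is the angle between $\boldsymbol R_1$ and $\boldsymbol R_2$, the vector $\boldsymbol m$ is the angular momentum in this frame, i.e. $\alpha(\xi\times \boldsymbol R_1,\xi\times \boldsymbol R_2)=m_x(e_x,\xi)+m_y(e_y,\xi)+m_z(e_z,\xi)$ for all $\xi\in\mathbb R^3$, and $p=\alpha(0,\cos q\,e_y-\sin q\,e_z)$. (3) With the same $\Psi$, for all masses $\mu_1,\mu_2>0$ and every potential $U:(0,\pi)\to\mathbb R$, let $H=T+U(q)$ on $T^*Q$, where $T$ is the kinetic energy $\frac12(\mu_1\|\dot{\boldsymbol R}_1\|^2+\mu_2\|\dot{\boldsymbol R}_2\|^2)$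 expressed through momenta by the Legendre transformation. Then $H=H_P\circ\Psi\circ\pi$ with $$H_P(\boldsymbol m,q,p)=\frac1{2\mu_1}\Big((\boldsymbol m,\mathbf A(q)\boldsymbol m)+2m_xp+(1+\mu)p^2\Big)+U(q),\qquad \mathbf A(q)=\begin{pmatrix}1&0&0\\0&1&\frac{\cos q}{\sin q}\\0&\frac{\cos q}{\sin q}&\frac{\mu+\cos^2q}{\sin^2q}\end{pmatrix},\quad \mu=\frac{\mu_1}{\mu_2}.$$ If $U$ is differentiable, then the reduced dynamics is Hamiltonian with Hamiltonian $H_P$: for every smooth $F$ on $P$ one has $\{F\circ\Psi\circ\pi,H\}=\{F,H_P\}_P\circ\Psi\circ\pi$, and $\Psi\circ\pi$ maps the trajectories of $H$ on $T^*Q$ to trajectories of $H_P$ on $P$. -/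

import Mathlib

open Set Manifold Bundle
open scoped ContDiff InnerProductSpace Matrix

noncomputable section

namespace TwoBody

/-! ### Cotangent bundles and their canonical Poisson bracket -/

section General

variable {E : Type*} [NormedAddCommGroup E] [NormedSpace ℝ E]
  {H : Type*} [TopologicalSpace H] (I : ModelWithCorners ℝ E H)
  (M : Type*) [TopologicalSpace M] [ChartedSpace H M]

/-- The fibre `T*_x M` of the cotangent bundle. -/
abbrev CotangentSpace (x : M) : Type _ := TangentSpace I x →L[ℝ] Bundle.Trivial M ℝ x

/-- The total space `T*M` of the cotangent bundle; its smooth structure is Mathlib's one on the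
bundle of continuous linear maps from the tangent bundle to the trivial line bundle. -/
abbrev CotangentBundle : Type _ := TotalSpace (E →L[ℝ] ℝ) (CotangentSpace I M)

/-- The model with corners of `T*M`. -/
abbrev cotangentModel : ModelWithCorners ℝ (E × (E →L[ℝ] ℝ)) (ModelProd H (E →L[ℝ] ℝ)) :=
  I.prod 𝓘(ℝ, E →L[ℝ] ℝ)

variable {M} [IsManifold I ∞ M]

/-- The canonical Poisson bracket on `T*M`,
`{f, h} = ∑ i, (∂f/∂xⁱ ∂h/∂ξᵢ - ∂h/∂xⁱ ∂f/∂ξᵢ)`.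
The differential at `z` of a function on `T*M` is expressed by `mfderiv` in the preferred chart of
`T*M` at `z`. That chart is the cotangent lift of the preferred chart of `M` at the base point of
`z`, so its coordinates `(x, ξ) ∈ E × E*` are canonical ones. The sum runs over a basis of `E` and
its dual basis. -/
def canonicalBracket [FiniteDimensional ℝ E] (f h : CotangentBundle I M → ℝ)
    (z : CotangentBundle I M) : ℝ :=
  let df : E × (E →L[ℝ] ℝ) →L[ℝ] ℝ := mfderiv (cotangentModel I) 𝓘(ℝ, ℝ) f z
  let dh : E × (E →L[ℝ] ℝ) →L[ℝ] ℝ := mfderiv (cotangentModel I) 𝓘(ℝ, ℝ) h z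
  let b := Module.finBasis ℝ E
  ∑ i, (df (b i, 0) * dh (0, LinearMap.toContinuousLinearMap (b.coord i))
    - dh (b i, 0) * df (0, LinearMap.toContinuousLinearMap (b.coord i)))

end General

/-! ### Poisson brackets, Poisson maps, Hamiltonian trajectories -/

section Poisson

variable {E : Type*} [NormedAddCommGroup E] [NormedSpace ℝ E]
  {H : Type*} [TopologicalSpace H] (I : ModelWithCorners ℝ E H)
  {M : Type*} [TopologicalSpace M] [ChartedSpace H M]
  {E' : Type*} [NormedAddCommGroup E'] [NormedSpace ℝ E']
  {H' : Type*} [TopologicalSpace H'] (I' : ModelWithCorners ℝ E' H')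
  {M' : Type*} [TopologicalSpace M'] [ChartedSpace H' M']

/-- `f` is a smooth real function. -/
abbrev SmoothFun (f : M → ℝ) : Prop := ContMDiff I 𝓘(ℝ, ℝ) ∞ f

/-- `br` is a Poisson bracket on the smooth functions of the manifold `M`. (Its values on other
functions are irrelevant.) -/
structure IsPoissonBracket (br : (M → ℝ) → (M → ℝ) → (M → ℝ)) : Prop where
  smooth : ∀ f h, SmoothFun I f → SmoothFun I h → SmoothFun I (br f h)
  skew : ∀ f h, SmoothFun I f → SmoothFun I h → br f h = -br h f
  add_left : ∀ f₁ f₂ h, SmoothFun I f₁ → SmoothFun I f₂ → SmoothFun I h →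
    br (f₁ + f₂) h = br f₁ h + br f₂ h
  smul_left : ∀ (c : ℝ) f h, SmoothFun I f → SmoothFun I h → br (c • f) h = c • br f h
  leibniz : ∀ f₁ f₂ h, SmoothFun I f₁ → SmoothFun I f₂ → SmoothFun I h →
    br (f₁ * f₂) h = f₁ * br f₂ h + f₂ * br f₁ h
  jacobi : ∀ f₁ f₂ f₃, SmoothFun I f₁ → SmoothFun I f₂ → SmoothFun I f₃ →
    br f₁ (br f₂ f₃) + br f₂ (br f₃ f₁) + br f₃ (br f₁ f₂) = 0

/-- The smooth map `φ` intertwines the brackets `br` on `M` and `br'` on `M'`. -/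
def IsPoissonMap (br : (M → ℝ) → (M → ℝ) → (M → ℝ)) (br' : (M' → ℝ) → (M' → ℝ) → (M' → ℝ))
    (φ : M → M') : Prop :=
  ContMDiff I I' ∞ φ ∧ ∀ f h : M' → ℝ, SmoothFun I' f → SmoothFun I' h →
    ∀ z, br (f ∘ φ) (h ∘ φ) z = br' f h (φ z)

/-- `c` is a smooth function that commutes with all smooth functions. -/
def IsCasimir (br : (M → ℝ) → (M → ℝ) → (M → ℝ)) (c : M → ℝ) : Prop :=
  SmoothFun I c ∧ ∀ f, SmoothFun I f → br c f = 0

/-- `γ : J → M` follows the Hamiltonian dynamics of `h`: `d/dt f(γ(t)) = {f, h}(γ(t))` for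
every smooth function `f`. -/
def IsHamiltonianTrajectory (br : (M → ℝ) → (M → ℝ) → (M → ℝ)) (h : M → ℝ) (J : Set ℝ)
    (γ : ℝ → M) : Prop :=
  ∀ t ∈ J, ∀ f, SmoothFun I f → HasDerivWithinAt (f ∘ γ) (br f h (γ t)) J t

/-- A smooth map whose differential is surjective at every point. -/
def IsSmoothSubmersion (φ : M → M') : Prop :=
  ContMDiff I I' ∞ φ ∧ ∀ z, Function.Surjective (mfderiv I I' φ z)

end Poisson

/-! ### Configuration and phase space of two bodies on the sphere -/

/-- Euclidean three-space. -/
abbrev E3 : Type := EuclideanSpace ℝ (Fin 3)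

/-- The vector product in `ℝ³`. -/
def cross (a b : E3) : E3 := WithLp.toLp 2 (a.ofLp ⨯₃ b.ofLp)

instance : Fact (Module.finrank ℝ E3 = 2 + 1) := ⟨by simp⟩

/-- The unit sphere in `ℝ³`. -/
abbrev S2 : Type := Metric.sphere (0 : E3) 1

/-- Pairs of points of the sphere that are neither equal nor antipodal, as an open submanifold
of `S² × S²`. -/
def configOpens : TopologicalSpace.Opens (S2 × S2) where
  carrier := {x | (x.1 : E3) ≠ x.2 ∧ (x.1 : E3) ≠ -(x.2 : E3)}
  is_open' := by
    apply IsOpen.inter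
    · exact isOpen_ne_fun (by fun_prop) (by fun_prop)
    · exact isOpen_ne_fun (by fun_prop) (by fun_prop)

/-- The configuration manifold `Q`. -/
abbrev Q : Type := configOpens

/-- The model with corners of `Q`. -/
abbrev modelQ := (𝓡 2).prod (𝓡 2)

/-- The model vector space of `Q`, to which all its tangent spaces reduce. -/
abbrev ModelSpace : Type := EuclideanSpace ℝ (Fin 2) × EuclideanSpace ℝ (Fin 2)

/-- The phase space `T*Q`. -/
abbrev TStarQ : Type := CotangentBundle modelQ Q

/-- The model with corners of `T*Q`. -/
abbrev modelTStarQ := cotangentModel modelQ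

/-- Position of the first body. -/
def R₁ (x : Q) : E3 := x.1.1

/-- Position of the second body. -/
def R₂ (x : Q) : E3 := x.1.2

/-- The velocities `(Ṙ₁, Ṙ₂)` in `ℝ³ × ℝ³` of a tangent vector at `x`: the differential of the
inclusion of `Q` into `ℝ³ × ℝ³`. -/
def velocity (x : Q) : TangentSpace modelQ x →L[ℝ] E3 × E3 :=
  mfderiv modelQ 𝓘(ℝ, E3 × E3) (fun y : Q => (R₁ y, R₂ y)) x

/-! ### The action of `SO(3)` -/

/-- The rotation group `SO(3)`. -/
abbrev SO3 : Type := Matrix.specialOrthogonalGroup (Fin 3) ℝ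

/-- Rotation of a vector. -/
def rot (g : SO3) (v : E3) : E3 := Matrix.toEuclideanLin (g : Matrix (Fin 3) (Fin 3) ℝ) v

theorem rot_one (v : E3) : rot 1 v = v := by
  ext i; simp [rot, Matrix.toEuclideanLin]

theorem rot_mul (g h : SO3) (v : E3) : rot (g * h) v = rot g (rot h v) := by
  ext i; simp [rot, Matrix.toEuclideanLin]

theorem norm_rot (g : SO3) (v : E3) : ‖rot g v‖ = ‖v‖ := by
  have hg : ((g : Matrix (Fin 3) (Fin 3) ℝ))ᵀ * (g : Matrix (Fin 3) (Fin 3) ℝ) = 1 := by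
    have := (Matrix.mem_specialOrthogonalGroup_iff.1 g.2).1
    exact (Matrix.mem_orthogonalGroup_iff' _ _).1 this
  have h : inner ℝ (rot g v) (rot g v) = inner ℝ v v := by
    simp only [rot, EuclideanSpace.inner_eq_star_dotProduct, star_trivial,
      Matrix.toEuclideanLin, Matrix.toLpLin_apply]
    rw [Matrix.dotProduct_mulVec, Matrix.vecMul_mulVec, hg]
    simp
  rw [real_inner_self_eq_norm_sq, real_inner_self_eq_norm_sq] at h
  exact (sq_eq_sq₀ (norm_nonneg _) (norm_nonneg _)).1 h

theorem rot_injective (g : SO3) : Function.Injective (rot g) := fun v w h => by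
  have := congrArg (rot g⁻¹) h
  simpa [← rot_mul, rot_one] using this

theorem rot_neg (g : SO3) (v : E3) : rot g (-v) = -rot g v := by simp [rot]

/-- `SO(3)` rotates both bodies simultaneously. -/
instance instSMulQ : SMul SO3 Q where
  smul g x := ⟨(⟨rot g (R₁ x), by simp [norm_rot, R₁]⟩, ⟨rot g (R₂ x), by simp [norm_rot, R₂]⟩),
    ⟨fun h => x.2.1 (rot_injective g h),
      fun h => x.2.2 (rot_injective g (h.trans (rot_neg g _).symm))⟩⟩

instance instMulActionQ : MulAction SO3 Q where
  one_smul x := by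
    apply Subtype.ext; apply Prod.ext <;> apply Subtype.ext
    · exact rot_one _
    · exact rot_one _
  mul_smul g h x := by
    apply Subtype.ext; apply Prod.ext <;> apply Subtype.ext
    · exact rot_mul g h _
    · exact rot_mul g h _

theorem R₁_smul (g : SO3) (x : Q) : R₁ (g • x) = rot g (R₁ x) := rfl

theorem R₂_smul (g : SO3) (x : Q) : R₂ (g • x) = rot g (R₂ x) := rfl

theorem contDiff_rot (g : SO3) : ContDiff ℝ ∞ (rot g) :=
  (LinearMap.toContinuousLinearMap
    (Matrix.toEuclideanLin (g : Matrix (Fin 3) (Fin 3) ℝ))).contDiff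

theorem contMDiff_R₁ : ContMDiff modelQ 𝓘(ℝ, E3) ∞ R₁ :=
  contMDiff_coe_sphere.comp (contMDiff_fst.comp contMDiff_subtype_val)

theorem contMDiff_R₂ : ContMDiff modelQ 𝓘(ℝ, E3) ∞ R₂ :=
  contMDiff_coe_sphere.comp (contMDiff_snd.comp contMDiff_subtype_val)

/-- A map into an open submanifold is smooth if it is smooth into the ambient manifold. -/
theorem contMDiff_of_val {N : Type*} [TopologicalSpace N] {H : Type*} [TopologicalSpace H]
    {E : Type*} [NormedAddCommGroup E] [NormedSpace ℝ E] {I : ModelWithCorners ℝ E H}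
    [ChartedSpace H N] {f : N → Q}
    (hf : ContMDiff I modelQ ∞ (fun y => (f y : S2 × S2))) : ContMDiff I modelQ ∞ f := by
  intro y
  rw [contMDiffAt_iff_target]
  exact ⟨(Topology.IsInducing.subtypeVal.continuous_iff.2 hf.continuous).continuousAt,
    (contMDiffAt_iff_target.1 (hf y)).2⟩

theorem contMDiff_smul (g : SO3) : ContMDiff modelQ modelQ ∞ (fun x : Q => g • x) := by
  apply contMDiff_of_val
  apply ContMDiff.prodMk
  · exact ContMDiff.codRestrict_sphere
      ((contDiff_rot g).contMDiff.comp contMDiff_R₁) _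
  · exact ContMDiff.codRestrict_sphere
      ((contDiff_rot g).contMDiff.comp contMDiff_R₂) _

/-- The differential of the rotation `x ↦ g • x` of `Q`. -/
def dSmul (g : SO3) (x : Q) : TangentSpace modelQ x →L[ℝ] TangentSpace modelQ (g • x) :=
  mfderiv modelQ modelQ (fun y : Q => g • y) x

theorem hasMFDerivAt_smul (g : SO3) (x : Q) :
    HasMFDerivAt modelQ modelQ (fun y : Q => g • y) x (dSmul g x) :=
  ((contMDiff_smul g).mdifferentiable (by simp) x).hasMFDerivAt

theorem mfderiv_eq_of_eq {f f' : Q → Q} (e : f = f') (x : Q) (L : ModelSpace →L[ℝ] ModelSpace)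
    (h : HasMFDerivAt modelQ modelQ f' x L) :
    (mfderiv modelQ modelQ f x : ModelSpace →L[ℝ] ModelSpace) = L := by
  subst e; exact h.mfderiv

/-- `dSmul` as an endomorphism of the model vector space, which is what tangent spaces unfold to. -/
def dSmulModel (g : SO3) (x : Q) : ModelSpace →L[ℝ] ModelSpace := dSmul g x

theorem dSmul_one (x : Q) : dSmulModel 1 x = ContinuousLinearMap.id ℝ ModelSpace :=
  mfderiv_eq_of_eq (funext fun y => one_smul SO3 y) x _ (hasMFDerivAt_id x)

theorem dSmul_mul (g h : SO3) (x : Q) :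
    dSmulModel (g * h) x = (dSmulModel g (h • x)).comp (dSmulModel h x) :=
  mfderiv_eq_of_eq (f' := (fun y : Q => g • y) ∘ (fun y : Q => h • y))
    (funext fun y => mul_smul g h y) x _
    ((hasMFDerivAt_smul g (h • x)).comp x (hasMFDerivAt_smul h x))

theorem dSmul_isInvertible (g : SO3) (x : Q) : (dSmulModel g x).IsInvertible := by
  have hA : (dSmulModel g⁻¹ (g • x)).comp (dSmulModel g x) =
      ContinuousLinearMap.id ℝ ModelSpace := by
    rw [← dSmul_mul, inv_mul_cancel, dSmul_one]
  have hB : (dSmulModel g x).comp (dSmulModel g⁻¹ (g • x)) =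
      ContinuousLinearMap.id ℝ ModelSpace := by
    have h := dSmul_mul g g⁻¹ (g • x)
    rw [inv_smul_smul, mul_inv_cancel, dSmul_one] at h
    exact h.symm
  exact ContinuousLinearMap.IsInvertible.of_inverse hB hA

/-- The cotangent lift of the rotation by `g`: the covector `α` at `x` goes to the covector
`α ∘ (d(g • ·)ₓ)⁻¹` at `g • x`. -/
instance instSMulTStarQ : SMul SO3 TStarQ where
  smul g z := ⟨g • z.proj, z.2.comp (dSmul g z.proj).inverse⟩

theorem mk_inverse_one {x y : Q} (h : y = x) (α A) (hA : A = ContinuousLinearMap.id ℝ ModelSpace) :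
    (⟨y, (α : ModelSpace →L[ℝ] ℝ).comp A.inverse⟩ : TStarQ) = ⟨x, α⟩ := by
  subst h hA; rw [ContinuousLinearMap.inverse_id]; rfl

theorem mk_inverse_mul {x y : Q} (h : y = x) (α A) {B C : ModelSpace →L[ℝ] ModelSpace}
    (hB : B.IsInvertible) (hA : A = B.comp C) :
    (⟨y, (α : ModelSpace →L[ℝ] ℝ).comp A.inverse⟩ : TStarQ)
      = ⟨x, (α.comp C.inverse).comp B.inverse⟩ := by
  subst h hA; rw [hB.inverse_comp_of_left]; rfl

instance instMulActionTStarQ : MulAction SO3 TStarQ where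
  one_smul z := mk_inverse_one (one_smul SO3 z.proj) z.2 (dSmulModel 1 z.proj) (dSmul_one z.proj)
  mul_smul g h z := mk_inverse_mul (mul_smul g h z.proj) z.2 (dSmulModel (g * h) z.proj)
    (dSmul_isInvertible g (h • z.proj)) (dSmul_mul g h z.proj)

/-- The reduced space `T*Q / SO(3)`, with the quotient topology. -/
abbrev OrbitSpace : Type := MulAction.orbitRel.Quotient SO3 TStarQ

/-- The projection `T*Q → T*Q / SO(3)`. -/
def orbitProj (z : TStarQ) : OrbitSpace := Quotient.mk _ z

/-! ### The Hamiltonian on `T*Q` -/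

/-- The angle `q ∈ (0, π)` subtended by the bodies. -/
def angleQ (x : Q) : ℝ := InnerProductGeometry.angle (R₁ x) (R₂ x)

/-- The kinetic energy `½ (μ₁ ‖Ṙ₁‖² + μ₂ ‖Ṙ₂‖²)` of a tangent vector. -/
def kineticEnergy (μ₁ μ₂ : ℝ) (x : Q) (v : TangentSpace modelQ x) : ℝ :=
  (μ₁ * ‖(velocity x v).1‖ ^ 2 + μ₂ * ‖(velocity x v).2‖ ^ 2) / 2

/-- `α = ∂T/∂v`, that is `α = μ₁ ⟪Ṙ₁, ·⟫ + μ₂ ⟪Ṙ₂, ·⟫`: the covector `α` is the momentum of the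
tangent vector `v`. -/
def IsMomentumOf (μ₁ μ₂ : ℝ) (x : Q) (α : CotangentSpace modelQ Q x) (v : TangentSpace modelQ x) :
    Prop :=
  ∀ w, (α w : ℝ) = μ₁ * ⟪(velocity x v).1, (velocity x w).1⟫_ℝ
    + μ₂ * ⟪(velocity x v).2, (velocity x w).2⟫_ℝ

/-- The kinetic energy as a function on `T*Q`, the Legendre transform of the kinetic energy on
tangent vectors. It assigns to the momentum of `v` the kinetic energy of `v`; see
`cotangentKineticEnergy_eq`. -/
def cotangentKineticEnergy (μ₁ μ₂ : ℝ) (z : TStarQ) : ℝ :=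
  ⨆ v : TangentSpace modelQ z.proj, ((z.2 v : ℝ) - kineticEnergy μ₁ μ₂ z.proj v)

theorem cotangentKineticEnergy_eq {μ₁ μ₂ : ℝ} (h₁ : 0 < μ₁) (h₂ : 0 < μ₂) (z : TStarQ)
    (v : TangentSpace modelQ z.proj) (hv : IsMomentumOf μ₁ μ₂ z.proj z.2 v) :
    cotangentKineticEnergy μ₁ μ₂ z = kineticEnergy μ₁ μ₂ z.proj v := by
  have key : ∀ w, (z.2 w : ℝ) - kineticEnergy μ₁ μ₂ z.proj w ≤ kineticEnergy μ₁ μ₂ z.proj v := by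
    intro w
    rw [hv w]
    have e₁ := norm_sub_sq_real (velocity z.proj v).1 (velocity z.proj w).1
    have e₂ := norm_sub_sq_real (velocity z.proj v).2 (velocity z.proj w).2
    have p₁ := mul_nonneg h₁.le (sq_nonneg ‖(velocity z.proj v).1 - (velocity z.proj w).1‖)
    have p₂ := mul_nonneg h₂.le (sq_nonneg ‖(velocity z.proj v).2 - (velocity z.proj w).2‖)
    rw [e₁] at p₁
    rw [e₂] at p₂
    unfold kineticEnergy
    nlinarith
  apply le_antisymm
  · exact ciSup_le key
  · refine le_trans (le_of_eq ?_) (le_ciSup ⟨_, Set.forall_mem_range.2 key⟩ v)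
    rw [hv v]
    simp only [kineticEnergy, real_inner_self_eq_norm_sq]
    ring

/-- The Hamiltonian `T + U(q)` on `T*Q`. -/
def hamiltonian (μ₁ μ₂ : ℝ) (U : ℝ → ℝ) (z : TStarQ) : ℝ :=
  cotangentKineticEnergy μ₁ μ₂ z + U (angleQ z.proj)

/-- The moving frame `(e_x, e_y, e_z)` of a configuration: `e_z` points to the first body, and the
second body lies in the half-plane of the combinations `y e_y + z e_z` with `y > 0`. -/
def bodyFrame (x : Q) : Fin 3 → E3 :=
  let ex := ‖cross (R₂ x) (R₁ x)‖⁻¹ • cross (R₂ x) (R₁ x)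
  ![ex, cross (R₁ x) ex, R₁ x]

/-! ### The reduced phase space `ℝ³ × (0, π) × ℝ` -/

/-- The vector space `ℝ³ × ℝ × ℝ` of triples `(m, q, p)`. -/
abbrev V : Type := E3 × ℝ × ℝ

/-- `ℝ³ × (0, π) × ℝ` as an open submanifold of `ℝ³ × ℝ × ℝ`. -/
def reducedOpens : TopologicalSpace.Opens V where
  carrier := {y | y.2.1 ∈ Set.Ioo 0 Real.pi}
  is_open' := isOpen_Ioo.preimage (by fun_prop)

/-- The reduced phase space. -/
abbrev ReducedSpace : Type := reducedOpens

/-- The coordinate functions `m_x, m_y, m_z` for `i = 0, 1, 2`. -/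
def mCoord (i : Fin 3) (y : ReducedSpace) : ℝ := y.1.1 i

/-- The coordinate function `q`. -/
def qCoord (y : ReducedSpace) : ℝ := y.1.2.1

/-- The coordinate function `p`. -/
def pCoord (y : ReducedSpace) : ℝ := y.1.2.2

/-- The derivative of `f` at `y` in the direction `v ∈ ℝ³ × ℝ × ℝ`. -/
def dirDeriv (f : ReducedSpace → ℝ) (y : ReducedSpace) (v : V) : ℝ :=
  mfderiv 𝓘(ℝ, V) 𝓘(ℝ, ℝ) f y v

/-- The gradient of `f` with respect to `m`. -/
def gradM (f : ReducedSpace → ℝ) (y : ReducedSpace) : E3 :=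
  WithLp.toLp 2 fun i => dirDeriv f y (EuclideanSpace.single i 1, 0, 0)

/-- The product of the Lie-Poisson bracket `-(m, ∂f/∂m × ∂h/∂m)` of `so(3)*` with the canonical
bracket in `(q, p)`. -/
def reducedBracket (f h : ReducedSpace → ℝ) (y : ReducedSpace) : ℝ :=
  -⟪y.1.1, cross (gradM f y) (gradM h y)⟫_ℝ
    + (dirDeriv f y (0, 1, 0) * dirDeriv h y (0, 0, 1)
      - dirDeriv h y (0, 1, 0) * dirDeriv f y (0, 0, 1))

/-- The matrix `A(q)`, for the mass ratio `μ = μ₁ / μ₂`. -/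
def matA (μ q : ℝ) : Matrix (Fin 3) (Fin 3) ℝ :=
  !![1, 0, 0;
     0, 1, Real.cos q / Real.sin q;
     0, Real.cos q / Real.sin q, (μ + Real.cos q ^ 2) / Real.sin q ^ 2]

/-- The reduced Hamiltonian
`(1 / 2μ₁) ((m, A(q) m) + 2 m_x p + (1 + μ) p²) + U(q)` with `μ = μ₁ / μ₂`. -/
def reducedHamiltonian (μ₁ μ₂ : ℝ) (U : ℝ → ℝ) (y : ReducedSpace) : ℝ :=
  let m := y.1.1
  let q := y.1.2.1
  let p := y.1.2.2
  let μ := μ₁ / μ₂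
  1 / (2 * μ₁) * (m.ofLp ⬝ᵥ (matA μ q *ᵥ m.ofLp) + 2 * m 0 * p + (1 + μ) * p ^ 2) + U q

end TwoBody

end

open TwoBody

/-! Everything rests on a frame of `TQ` adapted to the symmetry: the three fields that rotate both
bodies about the vectors `e_x, e_y, e_z` of the moving frame, and the field that moves the second
body alone so that the angle opens at unit rate. A covector `α` is determined by its values on this
frame. Those values are the components of `m` and the number `p`; together with the angle `q` they
form the reduction map `reduceMap : T*Q → P`.

The map is Poisson. For vector fields `X, Y` on `Q` the functions `α ↦ α(X)` and `α ↦ α(Y)` have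
canonical bracket `α(DX·Y - DY·X) = -α([X, Y])`, so only commutators are needed. The fields are
restrictions of fields on `ℝ³ × ℝ³`, where the commutators are computed (`fderiv_commutator`). An
infinitesimal rotation carries the moving frame along, and opening the angle leaves it fixed. Hence
the rotations about `e_i` and `e_j` have as commutator the rotation about `e_i × e_j`, and the
opening field commutes with the rotations (`coordDeriv_frameField_comm`, `coordDeriv_opening_comm`).
Finally, rotations do not change `q`, and the opening field has `dq = 1`. The chain rule gives
`canonicalBracket_comp_reduceMap`, for functions that are merely differentiable at the point
considered; this matters because `U` need not be smooth.

The fibres of the map are the `SO(3)`-orbits (`reduceVec_eq_iff`). The fields are equivariant, so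
the map is invariant. Conversely, configurations with the same angle are related by the rotation
that takes one moving frame to the other, and two covectors at the same point with the same values
on the frame coincide. The map is a submersion, hence open, so it descends to an open embedding of
the orbit space into `ℝ³ × ℝ × ℝ` with image `P`. This embedding serves as a global chart, and the
bracket on the orbit space is the one transported from `P`.

The Hamiltonian is computed by inverting the Legendre transformation in the same frame
(`cotangentKineticEnergy_eq_reduced`). The Jacobi identity on `P` is a polynomial identity in
gradients and symmetric Hessians (`bracketForm_jacobi`). -/

namespace TwoBody

/-! ### Differentials on open submanifolds -/

section OpensVal

variable {E : Type*} [NormedAddCommGroup E] [NormedSpace ℝ E]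
  {H : Type*} [TopologicalSpace H] {I : ModelWithCorners ℝ E H}
  {M : Type*} [TopologicalSpace M] [ChartedSpace H M]

/-- In the preferred charts, the inclusion of an open submanifold has the identity as its
differential. -/
theorem hasMFDerivAt_subtype_val {U : TopologicalSpace.Opens M} (x : U) :
    HasMFDerivAt I I (Subtype.val : U → M) x (ContinuousLinearMap.id ℝ E) := by
  refine ⟨continuous_subtype_val.continuousAt, ?_⟩
  have hu : extChartAt I x.1 x.1 ∈ (extChartAt I x.1).target := mem_extChartAt_target x.1
  have key : writtenInExtChartAt I I x (Subtype.val : U → M)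
      =ᶠ[nhdsWithin (extChartAt I x x) (range I)] id := by
    filter_upwards [extChartAt_target_mem_nhdsWithin (I := I) x] with u hu
    have h := (extChartAt I x).right_inv hu
    simpa [writtenInExtChartAt, extChartAt] using! h
  have := hasFDerivWithinAt_id (𝕜 := ℝ) (extChartAt I x x) (range I)
  exact this.congr_of_eventuallyEq key
    (key.eq_of_nhdsWithin (mem_range_self _))

end OpensVal

/-! ### Canonical coordinates on `T*M` and brackets of momentum functions -/

section Cotangent

variable {E : Type*} [NormedAddCommGroup E] [NormedSpace ℝ E]
  {H : Type*} [TopologicalSpace H] {I : ModelWithCorners ℝ E H}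
  {M : Type*} [TopologicalSpace M] [ChartedSpace H M] [IsManifold I ∞ M]

/-- A covector, as a functional on the model space. -/
noncomputable def fibreCovector (z : CotangentBundle I M) : E →L[ℝ] ℝ := z.2

/-- The function on `T*M` given by pairing covectors with the vector field `X`. -/
noncomputable def momentumFun (X : M → E) (z : CotangentBundle I M) : ℝ :=
  fibreCovector z (X z.proj)

variable (I) in
/-- The coordinate change of tangent vectors from the preferred chart at `x` to that at `x₀`. -/
noncomputable def tangentChange (x₀ x : M) : E →L[ℝ] E :=
  (trivializationAt E (TangentSpace I) x₀).continuousLinearMapAt ℝ x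

variable (I) in
/-- The vector field `X` in the preferred chart at `x₀`. -/
noncomputable def coordField (X : M → E) (x₀ : M) (u : E) : E :=
  tangentChange I x₀ ((extChartAt I x₀).symm u) (X ((extChartAt I x₀).symm u))

theorem tangentChange_self (x : M) (v : E) : tangentChange I x x v = v := by
  rw [tangentChange, TangentBundle.continuousLinearMapAt_trivializationAt_eq_core
    (mem_chart_source _ _)]
  exact (tangentBundleCore I M).coordChange_self (achart H x) x (mem_chart_source H x) v

/-- The differential of the inverse chart is the inverse of the tangent bundle trivialization, and
`tangentChange` is that trivialization. -/
theorem mfderiv_extChartAt_symm_tangentChange [I.Boundaryless] (x₀ : M) {u : E}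
    (hu : u ∈ (extChartAt I x₀).target) (v : E) :
    (mfderiv 𝓘(ℝ, E) I (extChartAt I x₀).symm u : E →L[ℝ] E)
      (tangentChange I x₀ ((extChartAt I x₀).symm u) v) = v := by
  have hs : (extChartAt I x₀).symm u ∈ (chartAt H x₀).source := by
    simpa using (extChartAt I x₀).map_target hu
  have e := TangentBundle.symmL_trivializationAt (I := I) hs
  rw [(extChartAt I x₀).right_inv hu, I.range_eq_univ, mfderivWithin_univ] at e
  have h := (trivializationAt E (TangentSpace I) x₀).symmL_continuousLinearMapAt (R := ℝ)
    (by simpa using hs) v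
  refine Eq.trans ?_ h
  exact congrArg (fun l : E →L[ℝ] E => l (tangentChange I x₀ ((extChartAt I x₀).symm u) v)) e.symm

theorem extChartAt_cotangent_fst (z z' : CotangentBundle I M) :
    (extChartAt (cotangentModel I) z z').1 = extChartAt I z.proj z'.proj := by
  rw [FiberBundle.extChartAt]; rfl

/-- The chart of `T*M` is the cotangent lift of a chart of `M`: covectors transform contragrediently
to vectors, so the pairing is preserved. The trivial line bundle contributes an identity factor. -/
theorem extChartAt_cotangent_snd (z z' : CotangentBundle I M)
    (h : z'.proj ∈ (chartAt H z.proj).source) (v : E) :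
    (extChartAt (cotangentModel I) z z').2 (tangentChange I z.proj z'.proj v)
        = fibreCovector z' v := by
  have e : (extChartAt (cotangentModel I) z z').2 = ContinuousLinearMap.inCoordinates E
      (TangentSpace I) ℝ (Bundle.Trivial M ℝ) z.proj z'.proj z.proj z'.proj z'.2 := by
    rw [FiberBundle.extChartAt]; rfl
  rw [e]
  refine Eq.trans (congrArg (fun l : ℝ →L[ℝ] ℝ => l (fibreCovector z'
    ((trivializationAt E (TangentSpace I) z.proj).symmL ℝ z'.proj
      (tangentChange I z.proj z'.proj v))))
    (Trivial.continuousLinearMapAt_trivialization ℝ M ℝ z'.proj)) ?_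
  exact congrArg (fibreCovector z')
    ((trivializationAt E (TangentSpace I) z.proj).symmL_continuousLinearMapAt (R := ℝ)
      (by simpa using h) v)

theorem extChartAt_cotangent_self_snd (z : CotangentBundle I M) :
    (extChartAt (cotangentModel I) z z).2 = fibreCovector z := by
  ext v
  rw [← extChartAt_cotangent_snd z z (mem_chart_source _ _) v, tangentChange_self]

/-- The familiar form `(u, ξ) ↦ ξ(X(u))`, valid on a whole chart domain and therefore available for
differentiation. -/
theorem momentumFun_eq (X : M → E) (z z' : CotangentBundle I M)
    (h : z'.proj ∈ (chartAt H z.proj).source) :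
    momentumFun X z' = (extChartAt (cotangentModel I) z z').2
      (coordField I X z.proj (extChartAt (cotangentModel I) z z').1) := by
  have h' : (extChartAt I z.proj).symm (extChartAt I z.proj z'.proj) = z'.proj :=
    (extChartAt I z.proj).left_inv (by simpa using h)
  rw [extChartAt_cotangent_fst, coordField, h', extChartAt_cotangent_snd z z' h]
  rfl

theorem coordField_self (X : M → E) (x₀ : M) :
    coordField I X x₀ (extChartAt I x₀ x₀) = X x₀ := by
  have h : (extChartAt I x₀).symm (extChartAt I x₀ x₀) = x₀ :=
    (extChartAt I x₀).left_inv (by simp)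
  rw [coordField, h, tangentChange_self]

theorem preimage_proj_chart_source_mem_nhds (z : CotangentBundle I M) :
    {z' : CotangentBundle I M | z'.proj ∈ (chartAt H z.proj).source} ∈ nhds z :=
  (FiberBundle.continuous_proj (E →L[ℝ] ℝ) (CotangentSpace I M)).continuousAt.preimage_mem_nhds
    ((chartAt H z.proj).open_source.mem_nhds (mem_chart_source _ _))

/-- `mfderiv` at `z` is already expressed in the preferred chart at `z`, so that chart has the
identity as its differential. -/
theorem hasMFDerivAt_extChartAt_self (z : CotangentBundle I M) :
    HasMFDerivAt (cotangentModel I) 𝓘(ℝ, E × (E →L[ℝ] ℝ))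
      (extChartAt (cotangentModel I) z) z (ContinuousLinearMap.id ℝ (E × (E →L[ℝ] ℝ))) := by
  have := (contMDiffAt_extChartAt (I := cotangentModel I) (n := 1) (x := z)).mdifferentiableAt
    one_ne_zero
  have h := this.hasMFDerivAt
  rwa [mfderiv_extChartAt_self] at h

theorem momentumFun_eventuallyEq (X : M → E) (z : CotangentBundle I M) :
    momentumFun X =ᶠ[nhds z] (fun y : E × (E →L[ℝ] ℝ) => y.2 (coordField I X z.proj y.1)) ∘
      extChartAt (cotangentModel I) z := by
  filter_upwards [preimage_proj_chart_source_mem_nhds z] with z' hz'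
  exact momentumFun_eq X z z' hz'

theorem contMDiffAt_momentumFun (X : M → E)
    (z : CotangentBundle I M) (hX : ContDiffAt ℝ ∞ (coordField I X z.proj)
      (extChartAt I z.proj z.proj)) :
    ContMDiffAt (cotangentModel I) 𝓘(ℝ, ℝ) ∞ (momentumFun X) z := by
  refine ContMDiffAt.congr_of_eventuallyEq ?_ (momentumFun_eventuallyEq X z)
  have h2 : ContMDiffAt (cotangentModel I) 𝓘(ℝ, E × (E →L[ℝ] ℝ)) ∞
      (extChartAt (cotangentModel I) z) z := contMDiffAt_extChartAt
  have h3 : ContDiffAt ℝ ∞ (fun y : E × (E →L[ℝ] ℝ) => y.2 (coordField I X z.proj y.1))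
      (extChartAt (cotangentModel I) z z) := by
    apply ContDiffAt.clm_apply contDiffAt_snd
    exact ContDiffAt.comp (g := coordField I X z.proj) _
      (by rwa [extChartAt_cotangent_fst]) contDiffAt_fst
  exact h3.contMDiffAt.comp z h2

/-- The covector `(b, η) ↦ l b + η v` on `E × E*`. -/
noncomputable def phaseCovector (l : E →L[ℝ] ℝ) (v : E) : E × (E →L[ℝ] ℝ) →L[ℝ] ℝ :=
  l.coprod (ContinuousLinearMap.apply ℝ ℝ v)

theorem phaseCovector_apply (l : E →L[ℝ] ℝ) (v b : E) (η : E →L[ℝ] ℝ) :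
    phaseCovector l v (b, η) = l b + η v := by
  simp [phaseCovector]

theorem hasMFDerivAt_momentumFun (X : M → E)
    (z : CotangentBundle I M) (A : E →L[ℝ] E) (hX : HasFDerivAt (coordField I X z.proj) A
      (extChartAt I z.proj z.proj)) :
    HasMFDerivAt (cotangentModel I) 𝓘(ℝ, ℝ) (momentumFun X) z
      (phaseCovector ((fibreCovector z).comp A) (X z.proj)) := by
  have h4 : HasFDerivAt (fun y : E × (E →L[ℝ] ℝ) => coordField I X z.proj y.1)
      (A.comp (ContinuousLinearMap.fst ℝ E (E →L[ℝ] ℝ))) (extChartAt (cotangentModel I) z z) := by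
    refine HasFDerivAt.comp (g := coordField I X z.proj) _ ?_ hasFDerivAt_fst
    rwa [extChartAt_cotangent_fst]
  have h3 := (hasFDerivAt_snd (𝕜 := ℝ) (p := extChartAt (cotangentModel I) z z)).clm_apply h4
  have h5 := (h3.hasMFDerivAt.comp z (hasMFDerivAt_extChartAt_self z)).congr_of_eventuallyEq (momentumFun_eventuallyEq X z)
  have e : (extChartAt (cotangentModel I) z z).2.comp
      (A.comp (ContinuousLinearMap.fst ℝ E (E →L[ℝ] ℝ))) +
      (ContinuousLinearMap.snd ℝ E (E →L[ℝ] ℝ)).flip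
        (coordField I X z.proj (extChartAt (cotangentModel I) z z).1) =
      phaseCovector ((fibreCovector z).comp A) (X z.proj) := by
    refine ContinuousLinearMap.ext fun y => ?_
    obtain ⟨b, η⟩ := y
    rw [phaseCovector_apply, extChartAt_cotangent_fst, coordField_self,
      extChartAt_cotangent_self_snd]
    rfl
  rw [← e]
  exact h5

theorem hasMFDerivAt_comp_proj [I.Boundaryless] {f : M → ℝ} (z : CotangentBundle I M) (l : E →L[ℝ] ℝ)
    (hf : HasMFDerivAt I 𝓘(ℝ, ℝ) f z.proj l) :
    HasMFDerivAt (cotangentModel I) 𝓘(ℝ, ℝ) (fun z' : CotangentBundle I M => f z'.proj) z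
      (phaseCovector l 0) := by
  have h4 : HasFDerivAt (fun y : E × (E →L[ℝ] ℝ) => (f ∘ (extChartAt I z.proj).symm) y.1)
      (l.comp (ContinuousLinearMap.fst ℝ E (E →L[ℝ] ℝ))) (extChartAt (cotangentModel I) z z) := by
    refine HasFDerivAt.comp (g := f ∘ (extChartAt I z.proj).symm) _ ?_ hasFDerivAt_fst
    rw [extChartAt_cotangent_fst]
    have := hf.2
    rw [I.range_eq_univ] at this
    exact hasFDerivWithinAt_univ.1 this
  have e : l.comp (ContinuousLinearMap.fst ℝ E (E →L[ℝ] ℝ)) = phaseCovector l 0 := by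
    refine ContinuousLinearMap.ext fun y => ?_
    obtain ⟨b, η⟩ := y
    rw [phaseCovector_apply]
    simp
  rw [← e]
  refine (h4.hasMFDerivAt.comp z (hasMFDerivAt_extChartAt_self z)).congr_of_eventuallyEq ?_
  filter_upwards [preimage_proj_chart_source_mem_nhds z] with z' hz'
  rw [Function.comp_apply, Function.comp_apply, extChartAt_cotangent_fst,
    (extChartAt I z.proj).left_inv (by simpa using hz')]

/-- The sums over the basis and its dual basis collapse to evaluations. For two momentum functions
the result is the covector evaluated on `DX·X' - DX'·X`, which is minus the Lie bracket of `X` and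
`X'`. -/
theorem canonicalBracket_eq [FiniteDimensional ℝ E] {f h : CotangentBundle I M → ℝ}
    {z : CotangentBundle I M} {l l' : E →L[ℝ] ℝ} {v v' : E}
    (hf : HasMFDerivAt (cotangentModel I) 𝓘(ℝ, ℝ) f z (phaseCovector l v))
    (hh : HasMFDerivAt (cotangentModel I) 𝓘(ℝ, ℝ) h z (phaseCovector l' v')) :
    canonicalBracket I f h z = l v' - l' v := by
  have key : ∀ (k : E →L[ℝ] ℝ) (w : E), ∑ i, k (Module.finBasis ℝ E i) *
      LinearMap.toContinuousLinearMap ((Module.finBasis ℝ E).coord i) w = k w := by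
    intro k w
    conv_rhs => rw [← (Module.finBasis ℝ E).sum_repr w]
    simp only [map_sum, map_smul, smul_eq_mul]
    exact Finset.sum_congr rfl fun i _ => by simp [mul_comm]
  rw [canonicalBracket, hf.mfderiv, hh.mfderiv, ← key l v', ← key l' v, ← Finset.sum_sub_distrib]
  refine Finset.sum_congr rfl fun i _ => ?_
  erw [phaseCovector_apply, phaseCovector_apply, phaseCovector_apply, phaseCovector_apply]
  simp

end Cotangent

/-! ### Vector fields on an immersed manifold as restrictions of ambient fields -/

section Immersion

variable {E : Type*} [NormedAddCommGroup E] [NormedSpace ℝ E]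
  {H : Type*} [TopologicalSpace H] {I : ModelWithCorners ℝ E H} [I.Boundaryless]
  {M : Type*} [TopologicalSpace M] [ChartedSpace H M]
  {F : Type*} [NormedAddCommGroup F] [NormedSpace ℝ F]

theorem contDiffAt_comp_extChartAt_symm {ι : M → F} (hι : ContMDiff I 𝓘(ℝ, F) ∞ ι) (x₀ : M) :
    ContDiffAt ℝ ∞ (ι ∘ (extChartAt I x₀).symm) (extChartAt I x₀ x₀) := by
  have := (contMDiffAt_iff.1 (hι x₀)).2
  rw [I.range_eq_univ, contDiffWithinAt_univ] at this
  exact this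

theorem hasFDerivAt_comp_extChartAt_symm {ι : M → F} {x₀ : M} {L : E →L[ℝ] F}
    (hL : HasMFDerivAt I 𝓘(ℝ, F) ι x₀ L) :
    HasFDerivAt (ι ∘ (extChartAt I x₀).symm) L (extChartAt I x₀ x₀) := by
  have := hL.2
  rw [I.range_eq_univ] at this
  exact hasFDerivWithinAt_univ.1 this

variable [IsManifold I ∞ M]

/-- The relation between `X` and `W`, read in one fixed chart. It holds on the whole chart domain
and so can be differentiated. -/
theorem fderiv_coordField {ι : M → F} {L : M → E →L[ℝ] F}
    (hL : ∀ x, HasMFDerivAt I 𝓘(ℝ, F) ι x (L x))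
    {X : M → E} {W : F → F} (hX : ∀ x, L x (X x) = W (ι x)) (x₀ : M) {u : E}
    (hu : u ∈ (extChartAt I x₀).target) :
    fderiv ℝ (ι ∘ (extChartAt I x₀).symm) u (coordField I X x₀ u) =
      W (ι ((extChartAt I x₀).symm u)) := by
  have h1 := mdifferentiableWithinAt_extChartAt_symm (I := I) hu
  rw [I.range_eq_univ, mdifferentiableWithinAt_univ] at h1
  have h2 := ((hL ((extChartAt I x₀).symm u)).comp u h1.hasMFDerivAt).hasFDerivAt
  have h3 : fderiv ℝ (ι ∘ (extChartAt I x₀).symm) u = (L ((extChartAt I x₀).symm u)).comp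
    (mfderiv 𝓘(ℝ, E) I (extChartAt I x₀).symm u : E →L[ℝ] E) := HasFDerivAt.fderiv h2
  rw [h3, ← hX]
  exact congrArg _ (mfderiv_extChartAt_symm_tangentChange x₀ hu _)

variable [FiniteDimensional ℝ E] [FiniteDimensional ℝ F]

/-- The field `X` is given only pointwise, as the preimage of `W` under the differential. With `G`
the immersion in the chart and `P` a left inverse of `L x₀`, the map `P ∘ dG` is invertible near the
base point, and there `X = (P ∘ dG)⁻¹ (P (W ∘ G))` is visibly smooth. -/
theorem contDiffAt_coordField {ι : M → F} (hι : ContMDiff I 𝓘(ℝ, F) ∞ ι) {L : M → E →L[ℝ] F}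
    (hL : ∀ x, HasMFDerivAt I 𝓘(ℝ, F) ι x (L x)) {x₀ : M} (hinj : Function.Injective (L x₀))
    {X : M → E} {W : F → F} (hW : ContDiffAt ℝ ∞ W (ι x₀))
    (hX : ∀ x, L x (X x) = W (ι x)) :
    ContDiffAt ℝ ∞ (coordField I X x₀) (extChartAt I x₀ x₀) := by
  obtain ⟨P, hP⟩ : ∃ P : F →L[ℝ] E, P.comp (L x₀) = ContinuousLinearMap.id ℝ E := by
    obtain ⟨P, hP⟩ := (L x₀ : E →ₗ[ℝ] F).exists_leftInverse_of_injective
      (LinearMap.ker_eq_bot.2 hinj)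
    exact ⟨LinearMap.toContinuousLinearMap P,
      ContinuousLinearMap.ext fun v => congrArg (fun l => l v) hP⟩
  set G := ι ∘ (extChartAt I x₀).symm with hG
  set u₀ := extChartAt I x₀ x₀ with hu₀
  have hGs : ContDiffAt ℝ ∞ G u₀ := contDiffAt_comp_extChartAt_symm hι x₀
  have hG0 : G u₀ = ι x₀ := by simp [hG, hu₀]
  have hG' : fderiv ℝ G u₀ = L x₀ := (hasFDerivAt_comp_extChartAt_symm (hL x₀)).fderiv
  have hN : ContDiffAt ℝ ∞ (fun u => P.comp (fderiv ℝ G u)) u₀ :=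
    contDiffAt_const.clm_comp (hGs.fderiv_right (m := ∞) (by simp))
  have hN0 : P.comp (fderiv ℝ G u₀) = (ContinuousLinearEquiv.refl ℝ E : E →L[ℝ] E) := by
    rw [hG', hP]; rfl
  have hinv : ContDiffAt ℝ ∞ (fun u => (P.comp (fderiv ℝ G u)).inverse) u₀ := by
    refine ContDiffAt.comp (g := ContinuousLinearMap.inverse) u₀ ?_ hN
    rw [hN0]
    exact contDiffAt_map_inverse _
  have hunit : ∀ᶠ u in nhds u₀, (P.comp (fderiv ℝ G u)).IsInvertible := by
    have := ContinuousLinearEquiv.nhds (ContinuousLinearEquiv.refl ℝ E)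
    rw [← hN0] at this
    exact hN.continuousAt.eventually this
  have hWG : ContDiffAt ℝ ∞ (fun u => P (W (G u))) u₀ :=
    P.contDiff.contDiffAt.comp u₀ (ContDiffAt.comp u₀ (by rwa [hG0]) hGs)
  refine (hinv.clm_apply hWG).congr_of_eventuallyEq ?_
  filter_upwards [hunit, (isOpen_extChartAt_target x₀).mem_nhds (mem_extChartAt_target x₀)]
    with u ⟨e, he⟩ hu
  have h := fderiv_coordField hL hX x₀ hu
  rw [← he, ContinuousLinearMap.inverse_equiv]
  change _ = e.symm (P (W (ι ((extChartAt I x₀).symm u))))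
  rw [← h, ← hG]
  have h' := congrArg (fun l : E →L[ℝ] E => l (coordField I X x₀ u)) he
  exact ((e.symm_apply_eq).2 h'.symm).symm

/-- Let the vector fields `X`, `X'` on `M` be restrictions of the ambient fields `W`, `W'`. Then
the commutator of their coordinate expressions is the restriction of that of `W`, `W'`. -/
theorem fderiv_commutator {ι : M → F} (hι : ContMDiff I 𝓘(ℝ, F) ∞ ι) {L : M → E →L[ℝ] F}
    (hL : ∀ x, HasMFDerivAt I 𝓘(ℝ, F) ι x (L x)) {x₀ : M} (hinj : Function.Injective (L x₀))
    {X X' : M → E} {W W' : F → F} (hW : ContDiffAt ℝ ∞ W (ι x₀))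
    (hW' : ContDiffAt ℝ ∞ W' (ι x₀)) (hX : ∀ x, L x (X x) = W (ι x))
    (hX' : ∀ x, L x (X' x) = W' (ι x)) :
    L x₀ (fderiv ℝ (coordField I X x₀) (extChartAt I x₀ x₀) (X' x₀) -
        fderiv ℝ (coordField I X' x₀) (extChartAt I x₀ x₀) (X x₀)) =
      fderiv ℝ W (ι x₀) (W' (ι x₀)) - fderiv ℝ W' (ι x₀) (W (ι x₀)) := by
  set G := ι ∘ (extChartAt I x₀).symm with hG
  set u₀ := extChartAt I x₀ x₀ with hu₀
  have hGs : ContDiffAt ℝ ∞ G u₀ := contDiffAt_comp_extChartAt_symm hι x₀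
  have hG0 : G u₀ = ι x₀ := by simp [hG, hu₀]
  have hG' : fderiv ℝ G u₀ = L x₀ := (hasFDerivAt_comp_extChartAt_symm (hL x₀)).fderiv
  have hD : DifferentiableAt ℝ (fderiv ℝ G) u₀ :=
    (hGs.fderiv_right (m := ∞) (by simp)).differentiableAt (by simp)
  -- The derivative of `dG(X) = W ∘ G` in the direction `b`. In the commutator the terms with the
  -- second derivative of `G` cancel by symmetry.
  have main : ∀ {X : M → E} {W : F → F}, ContDiffAt ℝ ∞ W (ι x₀) →
      (∀ x, L x (X x) = W (ι x)) → ∀ b : E,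
      fderiv ℝ (fderiv ℝ G) u₀ b (X x₀) + L x₀ (fderiv ℝ (coordField I X x₀) u₀ b) =
        fderiv ℝ W (ι x₀) (L x₀ b) := by
    intro X W hW hX b
    have hc : DifferentiableAt ℝ (coordField I X x₀) u₀ :=
      (contDiffAt_coordField hι hL hinj hW hX).differentiableAt (by simp)
    have h1 := hD.hasFDerivAt.clm_apply hc.hasFDerivAt
    have h2 : HasFDerivAt (fun u => W (G u)) ((fderiv ℝ W (ι x₀)).comp (L x₀)) u₀ := by
      refine HasFDerivAt.comp (g := W) u₀ ?_ (hG' ▸ (hGs.differentiableAt (by simp)).hasFDerivAt)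
      rw [hG0]
      exact (hW.differentiableAt (by simp)).hasFDerivAt
    have h3 : (fun u => fderiv ℝ G u (coordField I X x₀ u)) =ᶠ[nhds u₀] fun u => W (G u) := by
      filter_upwards [(isOpen_extChartAt_target x₀).mem_nhds (mem_extChartAt_target x₀)] with u hu
      exact fderiv_coordField hL hX x₀ hu
    have h4 := h1.unique (h2.congr_of_eventuallyEq h3)
    have h5 := congrArg (fun l : E →L[ℝ] F => l b) h4
    have h6 : coordField I X x₀ u₀ = X x₀ := coordField_self X x₀
    simp only [hG', h6, add_apply, ContinuousLinearMap.comp_apply,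
      ContinuousLinearMap.flip_apply] at h5
    rw [← h5]
    exact add_comm _ _
  have hsymm : fderiv ℝ (fderiv ℝ G) u₀ (X' x₀) (X x₀) = fderiv ℝ (fderiv ℝ G) u₀ (X x₀) (X' x₀) :=
    (hGs.isSymmSndFDerivAt (by simpa using WithTop.coe_le_coe.2 (le_top : (2 : ℕ∞) ≤ ⊤))).eq _ _
  rw [← hX' x₀, ← hX x₀, ← main hW hX, ← main hW' hX', map_sub, hsymm]
  abel

end Immersion

/-! ### The vector product on Euclidean three-space -/

section CrossProduct

theorem cross_add_left (a b c : E3) : cross (a + b) c = cross a c + cross b c := by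
  simp [cross]

theorem cross_add_right (a b c : E3) : cross a (b + c) = cross a b + cross a c := by
  simp [cross]

theorem cross_smul_left (r : ℝ) (a b : E3) : cross (r • a) b = r • cross a b := by
  simp [cross]

theorem cross_smul_right (r : ℝ) (a b : E3) : cross a (r • b) = r • cross a b := by
  simp [cross]

theorem cross_sub_left (a b c : E3) : cross (a - b) c = cross a c - cross b c := by
  simp [cross]

theorem cross_self (a : E3) : cross a a = 0 := by
  simp [cross]

theorem cross_zero_right (a : E3) : cross a 0 = 0 := by
  simp [cross]

theorem cross_zero_left (a : E3) : cross 0 a = 0 := by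
  simp [cross]

theorem cross_anticomm (a b : E3) : cross a b = -cross b a := by
  simp only [cross, ← WithLp.toLp_neg]
  rw [_root_.cross_anticomm]

/-- The Jacobi identity, used below to show that vector products of vectors rotating with angular
velocity `a` rotate in the same way. -/
theorem cross_cross (a b c : E3) :
    cross (cross a b) c = cross a (cross b c) - cross b (cross a c) := by
  simp only [cross, ← WithLp.toLp_sub]
  rw [_root_.cross_cross]

theorem inner_eq_sum (a b : E3) : ⟪a, b⟫_ℝ = a 0 * b 0 + a 1 * b 1 + a 2 * b 2 := by
  simp [PiLp.inner_apply, Fin.sum_univ_three, mul_comm]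

theorem cross_apply_zero (a b : E3) : cross a b 0 = a 1 * b 2 - a 2 * b 1 := by
  simp [cross, cross_apply]

theorem cross_apply_one (a b : E3) : cross a b 1 = a 2 * b 0 - a 0 * b 2 := by
  simp [cross, cross_apply]

theorem cross_apply_two (a b : E3) : cross a b 2 = a 0 * b 1 - a 1 * b 0 := by
  simp [cross, cross_apply]

theorem inner_cross_self_left (a b : E3) : ⟪a, cross a b⟫_ℝ = 0 := by
  simp only [inner_eq_sum, cross_apply_zero, cross_apply_one, cross_apply_two]; ring

theorem inner_cross_self_right (a b : E3) : ⟪b, cross a b⟫_ℝ = 0 := by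
  simp only [inner_eq_sum, cross_apply_zero, cross_apply_one, cross_apply_two]; ring

theorem inner_cross_perm (a b c : E3) : ⟪a, cross b c⟫_ℝ = ⟪b, cross c a⟫_ℝ := by
  simp only [inner_eq_sum, cross_apply_zero, cross_apply_one, cross_apply_two]; ring

theorem cross_cross_right (a b c : E3) :
    cross a (cross b c) = ⟪a, c⟫_ℝ • b - ⟪a, b⟫_ℝ • c := by
  ext i
  fin_cases i <;> simp [inner_eq_sum, cross_apply_zero, cross_apply_one, cross_apply_two] <;> ring

theorem inner_cross_cross (a b c d : E3) :
    ⟪cross a b, cross c d⟫_ℝ = ⟪a, c⟫_ℝ * ⟪b, d⟫_ℝ - ⟪a, d⟫_ℝ * ⟪b, c⟫_ℝ := by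
  simp only [inner_eq_sum, cross_apply_zero, cross_apply_one, cross_apply_two]; ring

theorem norm_cross_sq (a b : E3) : ‖cross a b‖ ^ 2 = ‖a‖ ^ 2 * ‖b‖ ^ 2 - ⟪a, b⟫_ℝ ^ 2 := by
  rw [← real_inner_self_eq_norm_sq, inner_cross_cross, real_inner_self_eq_norm_sq,
    real_inner_self_eq_norm_sq, real_inner_comm a b]
  ring

theorem contDiff_cross : ContDiff ℝ ∞ fun w : E3 × E3 => cross w.1 w.2 := by
  rw [contDiff_euclidean]
  intro i
  have h : ∀ i, ContDiff ℝ ∞ fun w : E3 × E3 => w.1 i := fun i => by fun_prop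
  have h' : ∀ i, ContDiff ℝ ∞ fun w : E3 × E3 => w.2 i := fun i => by fun_prop
  fin_cases i
  · simpa only [← cross_apply_zero] using! (((h 1).mul (h' 2)).sub ((h 2).mul (h' 1)))
  · simpa only [← cross_apply_one] using! (((h 2).mul (h' 0)).sub ((h 0).mul (h' 2)))
  · simpa only [← cross_apply_two] using! (((h 0).mul (h' 1)).sub ((h 1).mul (h' 0)))

theorem hasDerivAt_cross {f g : ℝ → E3} {f' g' : E3} {t : ℝ} (hf : HasDerivAt f f' t)
    (hg : HasDerivAt g g' t) :
    HasDerivAt (fun s => cross (f s) (g s)) (cross f' (g t) + cross (f t) g') t := by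
  let B : E3 →ₗ[ℝ] E3 →ₗ[ℝ] E3 := LinearMap.mk₂ ℝ cross cross_add_left cross_smul_left
    cross_add_right cross_smul_right
  let B' : E3 →L[ℝ] E3 →L[ℝ] E3 := LinearMap.toContinuousLinearMap
    ((LinearMap.toContinuousLinearMap (𝕜 := ℝ) (E := E3) (F' := E3)).toLinearMap ∘ₗ B)
  have := B'.hasDerivAt_of_bilinear (fun _ => hf) (fun _ => hg)
  rw [add_comm]
  exact this

/-- The derivative of a normalized curve of vectors. -/
theorem hasDerivAt_normalize {n : ℝ → E3} {n' : E3} {t : ℝ} (hn : HasDerivAt n n' t)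
    (h0 : n t ≠ 0) : HasDerivAt (fun s => ‖n s‖⁻¹ • n s)
      (‖n t‖⁻¹ • n' - (⟪n t, n'⟫_ℝ / ‖n t‖ ^ 3) • n t) t := by
  have hpos : ‖n t‖ ≠ 0 := norm_ne_zero_iff.2 h0
  have h1 : HasDerivAt (fun s => ‖n s‖) (⟪n t, n'⟫_ℝ / ‖n t‖) t := by
    have := hn.norm_sq.sqrt (by simpa using h0)
    simp only [Real.sqrt_sq (norm_nonneg _)] at this
    convert this using 1
    field_simp
  have h2 := (h1.inv hpos).smul hn
  have e : ‖n t‖⁻¹ • n' - (⟪n t, n'⟫_ℝ / ‖n t‖ ^ 3) • n t =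
      ‖n t‖⁻¹ • n' + (-(⟪n t, n'⟫_ℝ / ‖n t‖) / ‖n t‖ ^ 2) • n t := by
    rw [sub_eq_add_neg, ← neg_smul]
    congr 2
    field_simp
  rw [e]
  exact h2

end CrossProduct

/-! ### Tangent vectors of `Q` -/

/-- The inclusion of `Q` into `ℝ³ × ℝ³`. -/
def positions (x : Q) : E3 × E3 := (R₁ x, R₂ x)

/-- `velocity`, on the model space to which tangent spaces unfold. -/
noncomputable def velocityModel (x : Q) : ModelSpace →L[ℝ] E3 × E3 := velocity x

theorem contMDiff_positions : ContMDiff modelQ 𝓘(ℝ, E3 × E3) ∞ positions :=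
  contMDiff_R₁.prodMk_space contMDiff_R₂

theorem hasMFDerivAt_positions (x : Q) :
    HasMFDerivAt modelQ 𝓘(ℝ, E3 × E3) positions x (velocityModel x) :=
  (contMDiff_positions.mdifferentiable (by simp) x).hasMFDerivAt

/-- The differential of the inclusion of the sphere. -/
noncomputable def sphereVelocity (y : S2) : EuclideanSpace ℝ (Fin 2) →L[ℝ] E3 :=
  mfderiv (𝓡 2) 𝓘(ℝ, E3) ((↑) : S2 → E3) y

theorem hasMFDerivAt_coe_sphere (y : S2) :
    HasMFDerivAt (𝓡 2) 𝓘(ℝ, E3) ((↑) : S2 → E3) y (sphereVelocity y) :=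
  ((contMDiff_coe_sphere (m := ∞)).mdifferentiable (by simp) y).hasMFDerivAt

theorem sphereVelocity_injective (y : S2) : Function.Injective (sphereVelocity y) :=
  injective_mvfderiv_subtypeVal_sphere y

theorem exists_sphereVelocity_eq_iff (y : S2) (a : E3) :
    (∃ v, sphereVelocity y v = a) ↔ ⟪(y : E3), a⟫_ℝ = 0 := by
  rw [← Submodule.mem_orthogonal_singleton_iff_inner_right, ← range_mvfderiv_subtypeVal (n := 2) y]
  exact Iff.rfl

theorem velocityModel_apply (x : Q) (v : ModelSpace) :
    velocityModel x v = (sphereVelocity x.1.1 v.1, sphereVelocity x.1.2 v.2) := by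
  have h0 := hasMFDerivAt_subtype_val (I := modelQ) x
  have h1 : HasMFDerivAt modelQ 𝓘(ℝ, E3) R₁ x ((sphereVelocity x.1.1).comp
      ((ContinuousLinearMap.fst ℝ _ _).comp (ContinuousLinearMap.id ℝ ModelSpace))) :=
    (hasMFDerivAt_coe_sphere x.1.1).comp x ((hasMFDerivAt_fst x.1).comp x h0)
  have h2 : HasMFDerivAt modelQ 𝓘(ℝ, E3) R₂ x ((sphereVelocity x.1.2).comp
      ((ContinuousLinearMap.snd ℝ _ _).comp (ContinuousLinearMap.id ℝ ModelSpace))) :=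
    (hasMFDerivAt_coe_sphere x.1.2).comp x ((hasMFDerivAt_snd x.1).comp x h0)
  have h3 := hasMFDerivAt_unique h1 ((ContinuousLinearMap.fst ℝ E3 E3).hasMFDerivAt.comp x
    (hasMFDerivAt_positions x))
  have h4 := hasMFDerivAt_unique h2 ((ContinuousLinearMap.snd ℝ E3 E3).hasMFDerivAt.comp x
    (hasMFDerivAt_positions x))
  exact Prod.ext (congrArg (fun l : ModelSpace →L[ℝ] E3 => l v) h3).symm
    (congrArg (fun l : ModelSpace →L[ℝ] E3 => l v) h4).symm

theorem velocityModel_injective (x : Q) : Function.Injective (velocityModel x) := by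
  intro v w h
  rw [velocityModel_apply, velocityModel_apply, Prod.mk.injEq] at h
  exact Prod.ext (sphereVelocity_injective _ h.1) (sphereVelocity_injective _ h.2)

theorem exists_velocityModel_eq_iff (x : Q) (w : E3 × E3) :
    (∃ v, velocityModel x v = w) ↔ ⟪R₁ x, w.1⟫_ℝ = 0 ∧ ⟪R₂ x, w.2⟫_ℝ = 0 := by
  rw [R₁, R₂, ← exists_sphereVelocity_eq_iff, ← exists_sphereVelocity_eq_iff]
  constructor
  · rintro ⟨v, rfl⟩
    rw [velocityModel_apply]
    exact ⟨⟨_, rfl⟩, ⟨_, rfl⟩⟩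
  · rintro ⟨⟨a, ha⟩, ⟨b, hb⟩⟩
    exact ⟨(a, b), by rw [velocityModel_apply, ha, hb]⟩

/-! ### The moving frame -/

/-- The moving frame as a function on `ℝ³ × ℝ³`. -/
noncomputable def ambientFrame (w : E3 × E3) : Fin 3 → E3 :=
  let ex := ‖cross w.2 w.1‖⁻¹ • cross w.2 w.1
  ![ex, cross w.1 ex, w.1]

theorem ambientFrame_positions (x : Q) : ambientFrame (positions x) = bodyFrame x := rfl

theorem norm_R₁ (x : Q) : ‖R₁ x‖ = 1 := by simp [R₁]

theorem norm_R₂ (x : Q) : ‖R₂ x‖ = 1 := by simp [R₂]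

theorem cos_angleQ (x : Q) : Real.cos (angleQ x) = ⟪R₁ x, R₂ x⟫_ℝ := by
  rw [angleQ, InnerProductGeometry.cos_angle, norm_R₁, norm_R₂]; simp

theorem angleQ_mem_Ioo (x : Q) : angleQ x ∈ Ioo 0 Real.pi := by
  have h1 : ‖R₁ x‖ ≠ 0 := by simp [norm_R₁]
  have h0 : R₁ x ≠ 0 := norm_ne_zero_iff.1 h1
  refine ⟨lt_of_le_of_ne (InnerProductGeometry.angle_nonneg _ _) fun h => ?_,
    lt_of_le_of_ne (InnerProductGeometry.angle_le_pi _ _) fun h => ?_⟩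
  · have hc := cos_angleQ x
    rw [← h, Real.cos_zero] at hc
    exact x.2.1 ((inner_eq_one_iff_of_norm_eq_one (𝕜 := ℝ) (norm_R₁ x) (norm_R₂ x)).1 hc.symm)
  · change angleQ x = Real.pi at h
    have hc := cos_angleQ x
    rw [h, Real.cos_pi] at hc
    exact x.2.2 ((inner_eq_neg_one_iff_of_norm_eq_one (norm_R₁ x) (norm_R₂ x)).1 hc.symm)

theorem sin_angleQ_pos (x : Q) : 0 < Real.sin (angleQ x) :=
  Real.sin_pos_of_mem_Ioo (angleQ_mem_Ioo x)

theorem norm_cross_R (x : Q) : ‖cross (R₂ x) (R₁ x)‖ = Real.sin (angleQ x) := by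
  rw [← sq_eq_sq₀ (norm_nonneg _) (sin_angleQ_pos x).le, norm_cross_sq, Real.sin_sq, cos_angleQ,
    norm_R₁, norm_R₂, real_inner_comm]
  ring

theorem cross_R_ne_zero (x : Q) : cross (R₂ x) (R₁ x) ≠ 0 := by
  rw [← norm_ne_zero_iff, norm_cross_R]
  exact (sin_angleQ_pos x).ne'

theorem bodyFrame_zero (x : Q) :
    bodyFrame x 0 = (Real.sin (angleQ x))⁻¹ • cross (R₂ x) (R₁ x) := by
  rw [← norm_cross_R]; rfl

theorem bodyFrame_one (x : Q) : bodyFrame x 1 = cross (R₁ x) (bodyFrame x 0) := rfl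

theorem bodyFrame_two (x : Q) : bodyFrame x 2 = R₁ x := rfl

theorem inner_R₁_self (x : Q) : ⟪R₁ x, R₁ x⟫_ℝ = 1 := by
  rw [real_inner_self_eq_norm_sq, norm_R₁]; norm_num

/-- Since `sin q • e_y = R₁ × (R₂ × R₁)`, the double product formula gives `R₂ - cos q • R₁` for the
first summand. -/
theorem R₂_eq (x : Q) : R₂ x = Real.sin (angleQ x) • bodyFrame x 1
    + Real.cos (angleQ x) • bodyFrame x 2 := by
  rw [bodyFrame_one, bodyFrame_two, bodyFrame_zero, cross_smul_right, cross_cross_right,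
    smul_inv_smul₀ (sin_angleQ_pos x).ne', cos_angleQ, inner_R₁_self]
  simp

theorem inner_frame_zero_zero (x : Q) : ⟪bodyFrame x 0, bodyFrame x 0⟫_ℝ = 1 := by
  have h := (sin_angleQ_pos x).ne'
  rw [bodyFrame_zero, real_inner_smul_left, real_inner_smul_right, real_inner_self_eq_norm_sq,
    norm_cross_R]
  field_simp

theorem inner_frame_zero_two (x : Q) : ⟪bodyFrame x 0, R₁ x⟫_ℝ = 0 := by
  rw [bodyFrame_zero, real_inner_smul_left, real_inner_comm, inner_cross_self_right, mul_zero]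

theorem orthonormal_bodyFrame (x : Q) : Orthonormal ℝ (bodyFrame x) := by
  have h00 := inner_frame_zero_zero x
  have h02 := inner_frame_zero_two x
  have h22 := inner_R₁_self x
  have h11 : ⟪bodyFrame x 1, bodyFrame x 1⟫_ℝ = 1 := by
    rw [bodyFrame_one, inner_cross_cross, h00, h22, h02]; simp
  have h10 : ⟪bodyFrame x 1, bodyFrame x 0⟫_ℝ = 0 := by
    rw [bodyFrame_one, real_inner_comm, inner_cross_self_right]
  have h12 : ⟪bodyFrame x 1, R₁ x⟫_ℝ = 0 := by
    rw [bodyFrame_one, real_inner_comm, inner_cross_self_left]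
  rw [orthonormal_iff_ite]
  intro i j
  fin_cases i <;> fin_cases j
  exacts [h00, (real_inner_comm _ _).trans h10, h02, h10, h11, h12,
    (real_inner_comm _ _).trans h02, (real_inner_comm _ _).trans h12, h22]

/-- The moving frame as an orthonormal basis. -/
noncomputable def frameBasis (x : Q) : OrthonormalBasis (Fin 3) ℝ E3 :=
  OrthonormalBasis.mk (orthonormal_bodyFrame x) (by
    have := (basisOfOrthonormalOfCardEqFinrank (orthonormal_bodyFrame x) (by simp)).span_eq
    rw [coe_basisOfOrthonormalOfCardEqFinrank] at this
    exact this.ge)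

theorem sum_inner_bodyFrame (x : Q) (v : E3) : ∑ i, ⟪bodyFrame x i, v⟫_ℝ • bodyFrame x i = v := by
  have := (frameBasis x).sum_repr' v
  simpa [frameBasis] using this

theorem inner_bodyFrame (x : Q) (i j : Fin 3) :
    ⟪bodyFrame x i, bodyFrame x j⟫_ℝ = if i = j then 1 else 0 :=
  orthonormal_iff_ite.1 (orthonormal_bodyFrame x) i j

theorem cross_frame_zero_one (x : Q) : cross (bodyFrame x 0) (bodyFrame x 1) = bodyFrame x 2 := by
  rw [bodyFrame_one, cross_cross_right, inner_frame_zero_zero, inner_frame_zero_two, bodyFrame_two]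
  simp

theorem cross_frame_two_zero (x : Q) : cross (bodyFrame x 2) (bodyFrame x 0) = bodyFrame x 1 := rfl

theorem cross_frame_one_two (x : Q) : cross (bodyFrame x 1) (bodyFrame x 2) = bodyFrame x 0 := by
  rw [cross_anticomm, bodyFrame_one, bodyFrame_two, cross_cross_right, inner_R₁_self,
    real_inner_comm, inner_frame_zero_two]
  simp

theorem cross_frame_one_zero (x : Q) :
    cross (bodyFrame x 1) (bodyFrame x 0) = -bodyFrame x 2 := by
  rw [cross_anticomm, cross_frame_zero_one]

theorem cross_frame_zero_two (x : Q) :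
    cross (bodyFrame x 0) (bodyFrame x 2) = -bodyFrame x 1 := by
  rw [cross_anticomm, cross_frame_two_zero]

theorem cross_frame_two_one (x : Q) :
    cross (bodyFrame x 2) (bodyFrame x 1) = -bodyFrame x 0 := by
  rw [cross_anticomm, cross_frame_one_two]

/-- This is the derivative of `sin q e_y + cos q e_z` in `q` with the frame fixed, which is why `R₂
× e_x` serves as the velocity of the opening motion. -/
theorem cross_R₂_frame_zero (x : Q) : cross (R₂ x) (bodyFrame x 0) =
    Real.cos (angleQ x) • bodyFrame x 1 - Real.sin (angleQ x) • bodyFrame x 2 := by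
  rw [R₂_eq, cross_add_left, cross_smul_left, cross_smul_left, cross_frame_one_zero,
    cross_frame_two_zero, smul_neg]
  abel

/-! ### The vector fields that generate the reduced coordinates -/

/-- The infinitesimal rotation of both bodies about the `i`-th vector of the moving frame. -/
noncomputable def ambientRotation (i : Fin 3) (w : E3 × E3) : E3 × E3 :=
  (cross (ambientFrame w i) w.1, cross (ambientFrame w i) w.2)

/-- The motion of the second body that opens the angle at unit rate. -/
noncomputable def ambientOpening (w : E3 × E3) : E3 × E3 := (0, cross w.2 (ambientFrame w 0))

theorem exists_velocityModel_eq_rotation (x : Q) (ξ : E3) :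
    ∃ v, velocityModel x v = (cross ξ (R₁ x), cross ξ (R₂ x)) :=
  (exists_velocityModel_eq_iff x _).2 ⟨inner_cross_self_right _ _, inner_cross_self_right _ _⟩

/-- The tangent vector at `x` of the rotation with angular velocity `ξ`. -/
noncomputable def rotationField (x : Q) (ξ : E3) : ModelSpace :=
  (exists_velocityModel_eq_rotation x ξ).choose

theorem velocityModel_rotationField (x : Q) (ξ : E3) :
    velocityModel x (rotationField x ξ) = (cross ξ (R₁ x), cross ξ (R₂ x)) :=
  (exists_velocityModel_eq_rotation x ξ).choose_spec

theorem rotationField_add (x : Q) (ξ η : E3) :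
    rotationField x (ξ + η) = rotationField x ξ + rotationField x η := by
  apply velocityModel_injective x
  simp [velocityModel_rotationField, cross_add_left]

theorem rotationField_smul (x : Q) (c : ℝ) (ξ : E3) :
    rotationField x (c • ξ) = c • rotationField x ξ := by
  apply velocityModel_injective x
  simp [velocityModel_rotationField, cross_smul_left]

/-- The rotation about the `i`-th vector of the moving frame. -/
noncomputable def frameField (i : Fin 3) (x : Q) : ModelSpace := rotationField x (bodyFrame x i)

theorem velocityModel_frameField (i : Fin 3) (x : Q) :
    velocityModel x (frameField i x) = ambientRotation i (positions x) :=
  velocityModel_rotationField x _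

theorem exists_velocityModel_eq_opening (x : Q) :
    ∃ v, velocityModel x v = ambientOpening (positions x) :=
  (exists_velocityModel_eq_iff x _).2 ⟨inner_zero_right _, inner_cross_self_left _ _⟩

/-- The tangent vector at `x` that moves the second body and opens the angle at unit rate. -/
noncomputable def openingField (x : Q) : ModelSpace := (exists_velocityModel_eq_opening x).choose

theorem velocityModel_openingField (x : Q) :
    velocityModel x (openingField x) = ambientOpening (positions x) :=
  (exists_velocityModel_eq_opening x).choose_spec

theorem rotationField_eq_sum (x : Q) (ξ : E3) :
    rotationField x ξ = ∑ i, ⟪bodyFrame x i, ξ⟫_ℝ • frameField i x := by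
  conv_lhs => rw [← sum_inner_bodyFrame x ξ]
  simp only [Fin.sum_univ_three, rotationField_add, rotationField_smul, frameField]

/-- The vectors of the frame of `T_x Q` formed by the rotations and the opening of the angle. -/
noncomputable def tangentFrame (x : Q) : Option (Fin 3) → ModelSpace
  | some i => frameField i x
  | none => openingField x

/-- On the first body the rotations about `e_x` and `e_y` act as `-e_y` and `e_x`, while the other
two fields vanish; this disposes of two coefficients. On the second body the remaining fields are
`-sin q e_x` and `cos q e_y - sin q e_z`, which are independent because `sin q ≠ 0`. -/
theorem linearIndependent_tangentFrame (x : Q) : LinearIndependent ℝ (tangentFrame x) := by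
  rw [Fintype.linearIndependent_iff]
  intro g hg
  have h := congrArg (velocityModel x) hg
  have hs := (sin_angleQ_pos x).ne'
  have hne := (orthonormal_bodyFrame x).ne_zero
  simp only [Fintype.sum_option, Fin.sum_univ_three, tangentFrame, map_add, map_smul, map_zero,
    velocityModel_frameField, velocityModel_openingField, ambientRotation, ambientOpening,
    ambientFrame_positions] at h
  have h1 := congrArg Prod.fst h
  have h2 := congrArg Prod.snd h
  simp only [Prod.fst_add, Prod.snd_add, Prod.smul_fst, Prod.smul_snd, Prod.fst_zero,
    Prod.snd_zero, smul_zero, zero_add] at h1 h2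
  change g none • cross (R₂ x) (bodyFrame x 0) + (g (some 0) • cross (bodyFrame x 0) (R₂ x) +
    g (some 1) • cross (bodyFrame x 1) (R₂ x) + g (some 2) • cross (bodyFrame x 2) (R₂ x)) = 0 at h2
  change g (some 0) • cross (bodyFrame x 0) (bodyFrame x 2) + g (some 1) • cross (bodyFrame x 1)
    (bodyFrame x 2) + g (some 2) • cross (bodyFrame x 2) (bodyFrame x 2) = 0 at h1
  rw [cross_frame_zero_two, cross_frame_one_two, cross_self] at h1
  have g0 : g (some 0) = 0 := by
    have := congrArg (fun v => ⟪bodyFrame x 1, v⟫_ℝ) h1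
    simpa [inner_add_right, inner_smul_right, inner_bodyFrame, hne] using this
  have g1 : g (some 1) = 0 := by
    have := congrArg (fun v => ⟪bodyFrame x 0, v⟫_ℝ) h1
    simpa [inner_add_right, inner_smul_right, inner_bodyFrame, hne] using this
  rw [g0, g1, zero_smul, zero_smul, zero_add, zero_add, cross_R₂_frame_zero, R₂_eq, cross_add_right, cross_smul_right, cross_smul_right,
    cross_frame_two_one, cross_self] at h2
  have g2 : g (some 2) = 0 := by
    have := congrArg (fun v => ⟪bodyFrame x 0, v⟫_ℝ) h2
    simpa [inner_add_right, inner_sub_right, inner_smul_right, inner_bodyFrame, hne, hs] using this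
  have gn : g none = 0 := by
    have := congrArg (fun v => ⟪bodyFrame x 2, v⟫_ℝ) h2
    simpa [inner_add_right, inner_sub_right, inner_smul_right, inner_bodyFrame, hne, hs] using this
  rintro (_ | i)
  · exact gn
  · fin_cases i
    exacts [g0, g1, g2]

/-- The basis of `T_x Q` formed by the rotations and the opening of the angle. -/
noncomputable def tangentBasis (x : Q) : Module.Basis (Option (Fin 3)) ℝ ModelSpace :=
  basisOfLinearIndependentOfCardEqFinrank (linearIndependent_tangentFrame x) (by simp)

theorem tangentBasis_some (x : Q) (i : Fin 3) : tangentBasis x (some i) = frameField i x := by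
  simp [tangentBasis, tangentFrame]

theorem tangentBasis_none (x : Q) : tangentBasis x none = openingField x := by
  simp [tangentBasis, tangentFrame]

/-- A covector is determined by its values on the rotations and on the opening of the angle, and
these can be prescribed. -/
theorem covector_ext {x : Q} {α β : ModelSpace →L[ℝ] ℝ}
    (h : ∀ i, α (frameField i x) = β (frameField i x))
    (h' : α (openingField x) = β (openingField x)) : α = β := by
  have : (α : ModelSpace →ₗ[ℝ] ℝ) = β := by
    refine (tangentBasis x).ext ?_
    rintro (_ | i)
    · simpa [tangentBasis_none] using h'
    · simpa [tangentBasis_some] using h i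
  exact ContinuousLinearMap.coe_injective this

theorem exists_covector (x : Q) (m : Fin 3 → ℝ) (p : ℝ) : ∃ α : ModelSpace →L[ℝ] ℝ,
    (∀ i, α (frameField i x) = m i) ∧ α (openingField x) = p := by
  refine ⟨LinearMap.toContinuousLinearMap
    ((tangentBasis x).constr ℝ fun o => o.elim p m), fun i => ?_, ?_⟩
  · rw [← tangentBasis_some, LinearMap.coe_toContinuousLinearMap', Module.Basis.constr_basis]; rfl
  · rw [← tangentBasis_none, LinearMap.coe_toContinuousLinearMap', Module.Basis.constr_basis]; rfl

/-! ### Derivatives of the moving frame -/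

/-- Once differentiability is known, a directional derivative may be computed along a curve, where
the product rule for `cross` and the rule for normalized vectors apply. -/
theorem fderiv_apply_of_hasDerivAt_line {E F : Type*} [NormedAddCommGroup E] [NormedSpace ℝ E]
    [NormedAddCommGroup F] [NormedSpace ℝ F] {W : E → F} {p v : E} {D : F}
    (hW : DifferentiableAt ℝ W p)
    (h : ∀ w : ℝ → E, w 0 = p → HasDerivAt w v 0 → HasDerivAt (fun t => W (w t)) D 0) :
    fderiv ℝ W p v = D := by
  have hw : HasDerivAt (fun t : ℝ => p + t • v) v 0 := by
    simpa using ((hasDerivAt_id (0 : ℝ)).smul_const v).const_add p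
  have hw0 : (fun t : ℝ => p + t • v) 0 = p := by simp
  have h1 : HasFDerivAt W (fderiv ℝ W p) ((fun t : ℝ => p + t • v) 0) := by
    rw [hw0]; exact hW.hasFDerivAt
  exact (h1.comp_hasDerivAt 0 hw).unique (h _ hw0 hw)

section FrameDerivatives

variable {w : ℝ → E3 × E3} {x : Q}

/-- Infinitesimal equivariance of the frame. By the Jacobi identity `R₂ × R₁` rotates along with the
bodies; its velocity is orthogonal to it, so normalization adds no correction. Then `e_y = R₁ × e_x`
rotates as well. -/
theorem hasDerivAt_ambientFrame_rotation {a : E3} (h0 : w 0 = positions x)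
    (hw : HasDerivAt w (cross a (R₁ x), cross a (R₂ x)) 0) (i : Fin 3) :
    HasDerivAt (fun t => ambientFrame (w t) i) (cross a (bodyFrame x i)) 0 := by
  have h1 : HasDerivAt (fun t => (w t).1) (cross a (R₁ x)) 0 := hw.fst
  have h2 : HasDerivAt (fun t => (w t).2) (cross a (R₂ x)) 0 := hw.snd
  have e1 : (w 0).1 = R₁ x := by rw [h0]; rfl
  have e2 : (w 0).2 = R₂ x := by rw [h0]; rfl
  have hN : HasDerivAt (fun t => cross (w t).2 (w t).1) (cross a (cross (R₂ x) (R₁ x))) 0 := by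
    have := hasDerivAt_cross h2 h1
    rw [e1, e2, cross_cross a, sub_add_cancel] at this
    exact this
  have hX : HasDerivAt (fun t => ambientFrame (w t) 0) (cross a (bodyFrame x 0)) 0 := by
    have := hasDerivAt_normalize hN (by rw [e1, e2]; exact cross_R_ne_zero x)
    rw [e1, e2, inner_cross_self_right, zero_div, zero_smul, sub_zero, ← cross_smul_right] at this
    exact this
  fin_cases i
  · exact hX
  · have := hasDerivAt_cross h1 hX
    rw [e1, h0, ambientFrame_positions, cross_cross a, sub_add_cancel] at this
    exact this
  · exact h1

/-- The first body rests and the second moves within the plane of the two, so the normal `R₂ × R₁ =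
sin q e_x` changes only in length and its direction is stationary. -/
theorem hasDerivAt_ambientFrame_opening (h0 : w 0 = positions x)
    (hw : HasDerivAt w (0, cross (R₂ x) (bodyFrame x 0)) 0) (i : Fin 3) :
    HasDerivAt (fun t => ambientFrame (w t) i) 0 0 := by
  have h1 : HasDerivAt (fun t => (w t).1) 0 0 := hw.fst
  have h2 : HasDerivAt (fun t => (w t).2) (cross (R₂ x) (bodyFrame x 0)) 0 := hw.snd
  have e1 : (w 0).1 = R₁ x := by rw [h0]; rfl
  have e2 : (w 0).2 = R₂ x := by rw [h0]; rfl
  have hs := (sin_angleQ_pos x).ne'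
  have hN : HasDerivAt (fun t => cross (w t).2 (w t).1)
      (Real.cos (angleQ x) • bodyFrame x 0) 0 := by
    have := hasDerivAt_cross h2 h1
    rw [e1, cross_zero_right, add_zero, cross_R₂_frame_zero, ← bodyFrame_two, cross_sub_left,
      cross_smul_left, cross_smul_left, cross_self, cross_frame_one_two, smul_zero, sub_zero] at this
    exact this
  have hX : HasDerivAt (fun t => ambientFrame (w t) 0) 0 0 := by
    have := hasDerivAt_normalize hN (by rw [e1, e2]; exact cross_R_ne_zero x)
    have e3 : cross (R₂ x) (R₁ x) = Real.sin (angleQ x) • bodyFrame x 0 := by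
      rw [bodyFrame_zero, smul_inv_smul₀ hs]
    rw [e1, e2, norm_cross_R, e3, real_inner_smul_left, real_inner_smul_right,
      inner_frame_zero_zero, smul_smul, smul_smul, ← sub_smul] at this
    have e4 : (Real.sin (angleQ x))⁻¹ * Real.cos (angleQ x) - Real.sin (angleQ x) *
        (Real.cos (angleQ x) * 1) / Real.sin (angleQ x) ^ 3 * Real.sin (angleQ x) = 0 := by
      field_simp
      ring
    rw [e4, zero_smul] at this
    exact this
  fin_cases i
  · exact hX
  · have := hasDerivAt_cross h1 hX
    rw [cross_zero_left, cross_zero_right, add_zero] at this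
    exact this
  · exact h1

end FrameDerivatives

theorem contDiffAt_ambientFrame (x : Q) (i : Fin 3) :
    ContDiffAt ℝ ∞ (fun w => ambientFrame w i) (positions x) := by
  have hN : ContDiffAt ℝ ∞ (fun w : E3 × E3 => cross w.2 w.1) (positions x) :=
    (contDiff_cross.comp (contDiff_snd.prodMk contDiff_fst)).contDiffAt
  have hX : ContDiffAt ℝ ∞ (fun w => ambientFrame w 0) (positions x) :=
    ((hN.norm ℝ (cross_R_ne_zero x)).inv (norm_ne_zero_iff.2 (cross_R_ne_zero x))).smul hN
  fin_cases i
  · exact hX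
  · exact contDiff_cross.contDiffAt.comp _ (contDiffAt_fst.prodMk hX)
  · exact contDiffAt_fst

theorem contDiffAt_ambientRotation (x : Q) (i : Fin 3) :
    ContDiffAt ℝ ∞ (ambientRotation i) (positions x) :=
  (contDiff_cross.contDiffAt.comp _ ((contDiffAt_ambientFrame x i).prodMk contDiffAt_fst)).prodMk
    (contDiff_cross.contDiffAt.comp _ ((contDiffAt_ambientFrame x i).prodMk contDiffAt_snd))

theorem contDiffAt_ambientOpening (x : Q) : ContDiffAt ℝ ∞ ambientOpening (positions x) :=
  contDiffAt_const.prodMk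
    (contDiff_cross.contDiffAt.comp _ (contDiffAt_snd.prodMk (contDiffAt_ambientFrame x 0)))

/-- The product rule gives `(e_j × e_i) × R + e_i × (e_j × R)` for each body, as the axis `e_i` is
itself rotated; the Jacobi identity contracts the sum. -/
theorem fderiv_ambientRotation_rotation (x : Q) (i j : Fin 3) :
    fderiv ℝ (ambientRotation i) (positions x) (ambientRotation j (positions x)) =
      (cross (bodyFrame x j) (cross (bodyFrame x i) (R₁ x)),
        cross (bodyFrame x j) (cross (bodyFrame x i) (R₂ x))) := by
  refine fderiv_apply_of_hasDerivAt_line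
    ((contDiffAt_ambientRotation x i).differentiableAt (by simp)) fun w h0 hw => ?_
  have hf := hasDerivAt_ambientFrame_rotation h0 hw i
  have h1 := (hasDerivAt_cross hf hw.fst).prodMk (hasDerivAt_cross hf hw.snd)
  rw [h0, ambientFrame_positions] at h1
  refine h1.congr_deriv ?_
  change (cross (cross (bodyFrame x j) (bodyFrame x i)) (R₁ x) + cross (bodyFrame x i)
    (cross (bodyFrame x j) (R₁ x)), cross (cross (bodyFrame x j) (bodyFrame x i)) (R₂ x) +
    cross (bodyFrame x i) (cross (bodyFrame x j) (R₂ x))) = _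
  rw [cross_cross, cross_cross, sub_add_cancel, sub_add_cancel]

theorem fderiv_ambientRotation_opening (x : Q) (i : Fin 3) :
    fderiv ℝ (ambientRotation i) (positions x) (ambientOpening (positions x)) =
      (0, cross (bodyFrame x i) (cross (R₂ x) (bodyFrame x 0))) := by
  refine fderiv_apply_of_hasDerivAt_line
    ((contDiffAt_ambientRotation x i).differentiableAt (by simp)) fun w h0 hw => ?_
  have hf := hasDerivAt_ambientFrame_opening h0 hw i
  have h1 := (hasDerivAt_cross hf hw.fst).prodMk (hasDerivAt_cross hf hw.snd)
  rw [h0, ambientFrame_positions, cross_zero_left, cross_zero_left, zero_add, zero_add] at h1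
  refine h1.congr_deriv ?_
  change (cross (bodyFrame x i) 0, _) = _
  rw [cross_zero_right]
  rfl

/-- Rotation carries the opening velocity `R₂ × e_x` along as a vector. The value agrees with
`fderiv_ambientRotation_opening`, so the two fields commute. -/
theorem fderiv_ambientOpening_rotation (x : Q) (i : Fin 3) :
    fderiv ℝ ambientOpening (positions x) (ambientRotation i (positions x)) =
      (0, cross (bodyFrame x i) (cross (R₂ x) (bodyFrame x 0))) := by
  refine fderiv_apply_of_hasDerivAt_line
    ((contDiffAt_ambientOpening x).differentiableAt (by simp)) fun w h0 hw => ?_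
  have hf := hasDerivAt_ambientFrame_rotation h0 hw 0
  have h1 := (hasDerivAt_const (0 : ℝ) (0 : E3)).prodMk (hasDerivAt_cross hw.snd hf)
  rw [h0, ambientFrame_positions] at h1
  refine h1.congr_deriv ?_
  change ((0 : E3), cross (cross (bodyFrame x i) (R₂ x)) (bodyFrame x 0) +
    cross (R₂ x) (cross (bodyFrame x i) (bodyFrame x 0))) = _
  rw [cross_cross, sub_add_cancel]

/-! ### The angle -/

/-- The angle as a function on `ℝ³ × ℝ³`; the vectors are supposed to be unit vectors. -/
noncomputable def ambientAngle (w : E3 × E3) : ℝ := Real.arccos ⟪w.1, w.2⟫_ℝ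

theorem ambientAngle_positions (x : Q) : ambientAngle (positions x) = angleQ x := by
  have h := angleQ_mem_Ioo x
  change Real.arccos ⟪R₁ x, R₂ x⟫_ℝ = _
  rw [← cos_angleQ, Real.arccos_cos h.1.le h.2.le]

theorem inner_R_ne (x : Q) : ⟪R₁ x, R₂ x⟫_ℝ ≠ -1 ∧ ⟪R₁ x, R₂ x⟫_ℝ ≠ 1 := by
  have hs := sin_angleQ_pos x
  have h := Real.sin_sq_add_cos_sq (angleQ x)
  rw [← cos_angleQ]
  constructor <;> intro hc <;> rw [hc] at h <;> nlinarith

theorem contDiffAt_ambientAngle (x : Q) : ContDiffAt ℝ ∞ ambientAngle (positions x) :=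
  (Real.contDiffAt_arccos (inner_R_ne x).1 (inner_R_ne x).2).comp (positions x)
    (contDiffAt_fst.inner ℝ contDiffAt_snd)

theorem hasDerivAt_ambientAngle {w : ℝ → E3 × E3} {x : Q} {w' : E3 × E3} (h0 : w 0 = positions x)
    (hw : HasDerivAt w w' 0) : HasDerivAt (fun t => ambientAngle (w t))
      (-(1 / Real.sin (angleQ x)) * (⟪R₁ x, w'.2⟫_ℝ + ⟪w'.1, R₂ x⟫_ℝ)) 0 := by
  have h1 := HasDerivAt.inner ℝ (f := fun t => (w t).1) (g := fun t => (w t).2) hw.fst hw.snd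
  have e1 : (w 0).1 = R₁ x := by rw [h0]; rfl
  have e2 : (w 0).2 = R₂ x := by rw [h0]; rfl
  have h2 : HasDerivAt Real.arccos (-(1 / Real.sin (angleQ x))) ⟪(w 0).1, (w 0).2⟫_ℝ := by
    have := Real.hasDerivAt_arccos (inner_R_ne x).1 (inner_R_ne x).2
    rw [← cos_angleQ, ← Real.sin_eq_sqrt_one_sub_cos_sq (angleQ_mem_Ioo x).1.le
      (angleQ_mem_Ioo x).2.le] at this
    rw [e1, e2, ← cos_angleQ]
    exact this
  have h3 := h2.comp (0 : ℝ) h1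
  rw [e1, e2] at h3
  exact h3

theorem fderiv_ambientAngle_rotation (x : Q) (i : Fin 3) :
    fderiv ℝ ambientAngle (positions x) (ambientRotation i (positions x)) = 0 := by
  refine fderiv_apply_of_hasDerivAt_line
    ((contDiffAt_ambientAngle x).differentiableAt (by simp)) fun w h0 hw => ?_
  have h := hasDerivAt_ambientAngle h0 hw
  have e : ⟪R₁ x, cross (bodyFrame x i) (R₂ x)⟫_ℝ + ⟪cross (bodyFrame x i) (R₁ x), R₂ x⟫_ℝ = 0 := by
    rw [inner_cross_perm, cross_anticomm (bodyFrame x i) (R₁ x), inner_neg_left,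
      real_inner_comm (R₂ x), inner_cross_perm (R₂ x), inner_cross_perm (R₁ x),
      inner_cross_perm (bodyFrame x i), add_neg_cancel]
  refine h.congr_deriv ?_
  change _ * (⟪R₁ x, cross (bodyFrame x i) (R₂ x)⟫_ℝ +
    ⟪cross (bodyFrame x i) (R₁ x), R₂ x⟫_ℝ) = 0
  rw [e, mul_zero]

/-- The factor `-1 / sin q` from `arccos` cancels the inner product `-sin q` of `R₁` with the
opening velocity; thus `p` is conjugate to `q`. -/
theorem fderiv_ambientAngle_opening (x : Q) :
    fderiv ℝ ambientAngle (positions x) (ambientOpening (positions x)) = 1 := by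
  refine fderiv_apply_of_hasDerivAt_line
    ((contDiffAt_ambientAngle x).differentiableAt (by simp)) fun w h0 hw => ?_
  refine (hasDerivAt_ambientAngle h0 hw).congr_deriv ?_
  change _ * (⟪R₁ x, cross (R₂ x) (bodyFrame x 0)⟫_ℝ + ⟪(0 : E3), R₂ x⟫_ℝ) = 1
  have hs := (sin_angleQ_pos x).ne'
  rw [cross_R₂_frame_zero, ← bodyFrame_two, inner_sub_right, inner_smul_right, inner_smul_right,
    inner_bodyFrame, inner_bodyFrame]
  simp [hs]

theorem hasMFDerivAt_angleQ (x : Q) : HasMFDerivAt modelQ 𝓘(ℝ, ℝ) angleQ x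
    ((fderiv ℝ ambientAngle (positions x)).comp (velocityModel x)) := by
  have h := (((contDiffAt_ambientAngle x).differentiableAt
    (by simp)).hasFDerivAt.hasMFDerivAt).comp x (hasMFDerivAt_positions x)
  have e : ambientAngle ∘ positions = angleQ := funext ambientAngle_positions
  rw [e] at h
  exact h

theorem contMDiff_angleQ : ContMDiff modelQ 𝓘(ℝ, ℝ) ∞ angleQ := by
  have e : ambientAngle ∘ positions = angleQ := funext ambientAngle_positions
  rw [← e]
  exact fun x => (contDiffAt_ambientAngle x).contMDiffAt.comp x (contMDiff_positions x)

/-! ### Commutators in canonical coordinates -/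

/-- The derivative of a vector field on `Q` in the preferred chart at `x`. -/
noncomputable def coordDeriv (X : Q → ModelSpace) (x : Q) : ModelSpace →L[ℝ] ModelSpace :=
  fderiv ℝ (coordField modelQ X x) (extChartAt modelQ x x)

theorem contDiffAt_coordField_frameField (x : Q) (i : Fin 3) :
    ContDiffAt ℝ ∞ (coordField modelQ (frameField i) x) (extChartAt modelQ x x) :=
  contDiffAt_coordField contMDiff_positions hasMFDerivAt_positions (velocityModel_injective x)
    (contDiffAt_ambientRotation x i) (velocityModel_frameField i)

theorem contDiffAt_coordField_openingField (x : Q) :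
    ContDiffAt ℝ ∞ (coordField modelQ openingField x) (extChartAt modelQ x x) :=
  contDiffAt_coordField contMDiff_positions hasMFDerivAt_positions (velocityModel_injective x)
    (contDiffAt_ambientOpening x) velocityModel_openingField

/-- The source of the minus sign in `{m_x, m_y} = -m_z`: the left-hand side is minus the Lie bracket
of the two fields, and that bracket is the rotation about `e_i × e_j`, since the axes move with the
bodies. -/
theorem coordDeriv_frameField_comm (x : Q) (i j : Fin 3) :
    coordDeriv (frameField i) x (frameField j x) - coordDeriv (frameField j) x (frameField i x) =
      -rotationField x (cross (bodyFrame x i) (bodyFrame x j)) := by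
  apply velocityModel_injective x
  rw [coordDeriv, coordDeriv, fderiv_commutator contMDiff_positions hasMFDerivAt_positions
    (velocityModel_injective x) (contDiffAt_ambientRotation x i) (contDiffAt_ambientRotation x j)
    (velocityModel_frameField i) (velocityModel_frameField j), fderiv_ambientRotation_rotation,
    fderiv_ambientRotation_rotation, map_neg, velocityModel_rotationField, cross_cross, cross_cross,
    Prod.mk_sub_mk, Prod.neg_mk, neg_sub, neg_sub]

theorem coordDeriv_opening_comm (x : Q) (i : Fin 3) :
    coordDeriv (frameField i) x (openingField x) -
      coordDeriv openingField x (frameField i x) = 0 := by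
  apply velocityModel_injective x
  rw [coordDeriv, coordDeriv, fderiv_commutator contMDiff_positions hasMFDerivAt_positions
    (velocityModel_injective x) (contDiffAt_ambientRotation x i) (contDiffAt_ambientOpening x)
    (velocityModel_frameField i) velocityModel_openingField, fderiv_ambientRotation_opening,
    fderiv_ambientOpening_rotation, sub_self, map_zero]

/-! ### The reduction map -/

/-- The reduced coordinates of a covector, in the vector space `ℝ³ × ℝ × ℝ`. -/
noncomputable def reduceVec (z : TStarQ) : V :=
  (WithLp.toLp 2 fun i => momentumFun (frameField i) z, angleQ z.proj, momentumFun openingField z)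

/-- The reduced coordinates of a covector. -/
noncomputable def reduceMap (z : TStarQ) : ReducedSpace := ⟨reduceVec z, angleQ_mem_Ioo z.proj⟩

theorem contMDiff_momentumFun_frameField (i : Fin 3) :
    ContMDiff modelTStarQ 𝓘(ℝ, ℝ) ∞ (momentumFun (I := modelQ) (frameField i)) := fun z =>
  contMDiffAt_momentumFun _ z (contDiffAt_coordField_frameField z.proj i)

theorem contMDiff_momentumFun_openingField :
    ContMDiff modelTStarQ 𝓘(ℝ, ℝ) ∞ (momentumFun (I := modelQ) openingField) := fun z =>
  contMDiffAt_momentumFun _ z (contDiffAt_coordField_openingField z.proj)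

theorem contMDiff_reduceVec : ContMDiff modelTStarQ 𝓘(ℝ, V) ∞ reduceVec := by
  refine ContMDiff.prodMk_space ?_ (ContMDiff.prodMk_space ?_ contMDiff_momentumFun_openingField)
  · have h1 : ContMDiff modelTStarQ 𝓘(ℝ, Fin 3 → ℝ) ∞
        fun z : TStarQ => fun i => momentumFun (frameField i) z :=
      contMDiff_pi_space.2 contMDiff_momentumFun_frameField
    exact (PiLp.contDiff_toLp (n := ∞)).contMDiff.comp h1
  · exact contMDiff_angleQ.comp
      (contMDiff_proj (CotangentSpace modelQ Q) : ContMDiff modelTStarQ modelQ ∞ _)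

theorem contMDiff_of_opens_val {N : Type*} [TopologicalSpace N] {H : Type*} [TopologicalSpace H]
    {E : Type*} [NormedAddCommGroup E] [NormedSpace ℝ E] {I : ModelWithCorners ℝ E H}
    [ChartedSpace H N] {f : N → ReducedSpace}
    (hf : ContMDiff I 𝓘(ℝ, V) ∞ (fun y => (f y : V))) : ContMDiff I 𝓘(ℝ, V) ∞ f := by
  intro y
  rw [contMDiffAt_iff_target]
  exact ⟨(Topology.IsInducing.subtypeVal.continuous_iff.2 hf.continuous).continuousAt,
    (contMDiffAt_iff_target.1 (hf y)).2⟩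

theorem contMDiff_reduceMap : ContMDiff modelTStarQ 𝓘(ℝ, V) ∞ reduceMap :=
  contMDiff_of_opens_val contMDiff_reduceVec

/-! ### Functions on the reduced space -/

theorem mfderiv_comp_val {f : V → ℝ} {y : ReducedSpace} (hf : DifferentiableAt ℝ f y.1) :
    HasMFDerivAt 𝓘(ℝ, V) 𝓘(ℝ, ℝ) (fun y : ReducedSpace => f y.1) y (fderiv ℝ f y.1) :=
  hf.hasFDerivAt.hasMFDerivAt.comp y (hasMFDerivAt_subtype_val (I := 𝓘(ℝ, V)) y)

theorem dirDeriv_comp_val {f : V → ℝ} {y : ReducedSpace} (hf : DifferentiableAt ℝ f y.1) (v : V) :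
    dirDeriv (fun y : ReducedSpace => f y.1) y v = fderiv ℝ f y.1 v := by
  rw [dirDeriv, (mfderiv_comp_val hf).mfderiv]
  rfl

/-- The extension by zero of a function on the reduced space to `ℝ³ × ℝ × ℝ`. -/
noncomputable def extendFun (f : ReducedSpace → ℝ) : V → ℝ := Function.extend Subtype.val f 0

theorem extendFun_val (f : ReducedSpace → ℝ) (y : ReducedSpace) : extendFun f y.1 = f y :=
  Subtype.val_injective.extend_apply f 0 y

theorem extendFun_comp_val (f : ReducedSpace → ℝ) :
    (fun y : ReducedSpace => extendFun f y.1) = f :=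
  funext (extendFun_val f)

/-- The reduced space is open, so the values of the extension outside it do not matter near `y`. -/
theorem contDiffAt_extendFun {f : ReducedSpace → ℝ} (hf : SmoothFun 𝓘(ℝ, V) f) (y : ReducedSpace) :
    ContDiffAt ℝ ∞ (extendFun f) y.1 := by
  rw [← contMDiffAt_iff_contDiffAt, ← contMDiffAt_subtype_iff, extendFun_comp_val]
  exact hf y

theorem smoothFun_comp_val {f : V → ℝ} (hf : ∀ y : ReducedSpace, ContDiffAt ℝ ∞ f y.1) :
    SmoothFun 𝓘(ℝ, V) (fun y : ReducedSpace => f y.1) := fun y =>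
  contMDiffAt_subtype_iff.2 (hf y).contMDiffAt

/-! ### The reduction map is Poisson -/

/-- The part of the differential of the pullback of a function, with differential `a`, that
acts on positions. -/
noncomputable def pullbackBase (z : TStarQ) (a : V →L[ℝ] ℝ) : ModelSpace →L[ℝ] ℝ :=
  (∑ i, a (EuclideanSpace.single i 1, 0, 0) •
      (fibreCovector z).comp (coordDeriv (frameField i) z.proj)) +
    (a (0, 1, 0) • (fderiv ℝ ambientAngle (positions z.proj)).comp (velocityModel z.proj) +
    a (0, 0, 1) • (fibreCovector z).comp (coordDeriv openingField z.proj))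

/-- The part of the differential of the pullback of a function, with differential `a`, that
acts on momenta. -/
noncomputable def pullbackFibre (x : Q) (a : V →L[ℝ] ℝ) : ModelSpace :=
  (∑ i, a (EuclideanSpace.single i 1, 0, 0) • frameField i x) + a (0, 0, 1) • openingField x

theorem V_eq_sum (v : V) : v = (∑ i, v.1 i • ((EuclideanSpace.single i 1, 0, 0) : V)) +
    (v.2.1 • ((0, 1, 0) : V) + v.2.2 • ((0, 0, 1) : V)) := by
  refine Prod.ext ?_ (Prod.ext ?_ ?_)
  · ext i
    fin_cases i <;> simp [Fin.sum_univ_three]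
  · simp [Fin.sum_univ_three]
  · simp [Fin.sum_univ_three]

theorem apply_V (a : V →L[ℝ] ℝ) (v : V) : a v =
    (∑ i, v.1 i * a (EuclideanSpace.single i 1, 0, 0)) +
      (v.2.1 * a (0, 1, 0) + v.2.2 * a (0, 0, 1)) := by
  conv_lhs => rw [V_eq_sum v]
  simp only [map_add, map_sum, map_smul, smul_eq_mul]

theorem hasMFDerivAt_momentumFun_frameField (i : Fin 3) (z : TStarQ) :
    HasMFDerivAt modelTStarQ 𝓘(ℝ, ℝ) (momentumFun (I := modelQ) (frameField i)) z
      (phaseCovector ((fibreCovector z).comp (coordDeriv (frameField i) z.proj))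
        (frameField i z.proj)) :=
  hasMFDerivAt_momentumFun _ z _
    ((contDiffAt_coordField_frameField z.proj i).differentiableAt (by simp)).hasFDerivAt

theorem hasMFDerivAt_momentumFun_openingField (z : TStarQ) :
    HasMFDerivAt modelTStarQ 𝓘(ℝ, ℝ) (momentumFun (I := modelQ) openingField) z
      (phaseCovector ((fibreCovector z).comp (coordDeriv openingField z.proj))
        (openingField z.proj)) :=
  hasMFDerivAt_momentumFun _ z _
    ((contDiffAt_coordField_openingField z.proj).differentiableAt (by simp)).hasFDerivAt

theorem hasMFDerivAt_angleQ_proj (z : TStarQ) :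
    HasMFDerivAt modelTStarQ 𝓘(ℝ, ℝ) (fun z : TStarQ => angleQ z.proj) z
      (phaseCovector ((fderiv ℝ ambientAngle (positions z.proj)).comp (velocityModel z.proj)) 0) :=
  hasMFDerivAt_comp_proj z _ (hasMFDerivAt_angleQ z.proj)

/-- The differential of the reduction map in canonical coordinates. -/
noncomputable def reduceDeriv (z : TStarQ) : ModelSpace × (ModelSpace →L[ℝ] ℝ) →L[ℝ] V :=
  mfderiv modelTStarQ 𝓘(ℝ, V) reduceVec z

theorem hasMFDerivAt_reduceVec (z : TStarQ) :
    HasMFDerivAt modelTStarQ 𝓘(ℝ, V) reduceVec z (reduceDeriv z) :=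
  (contMDiff_reduceVec.mdifferentiable (by simp) z).hasMFDerivAt

theorem reduceDeriv_m (z : TStarQ) (y : ModelSpace × (ModelSpace →L[ℝ] ℝ)) (i : Fin 3) :
    (reduceDeriv z y).1 i = phaseCovector ((fibreCovector z).comp
      (coordDeriv (frameField i) z.proj)) (frameField i z.proj) y := by
  have h := hasMFDerivAt_unique (hasMFDerivAt_momentumFun_frameField i z)
    (((EuclideanSpace.proj i).comp (ContinuousLinearMap.fst ℝ E3 (ℝ × ℝ))).hasMFDerivAt.comp z
      (hasMFDerivAt_reduceVec z))
  exact (congrArg (fun l : ModelSpace × (ModelSpace →L[ℝ] ℝ) →L[ℝ] ℝ => l y) h).symm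

theorem reduceDeriv_q (z : TStarQ) (y : ModelSpace × (ModelSpace →L[ℝ] ℝ)) :
    (reduceDeriv z y).2.1 = phaseCovector
      ((fderiv ℝ ambientAngle (positions z.proj)).comp (velocityModel z.proj)) 0 y := by
  have h := hasMFDerivAt_unique (hasMFDerivAt_angleQ_proj z)
    (((ContinuousLinearMap.fst ℝ ℝ ℝ).comp (ContinuousLinearMap.snd ℝ E3 (ℝ × ℝ))).hasMFDerivAt.comp
      z (hasMFDerivAt_reduceVec z))
  exact (congrArg (fun l : ModelSpace × (ModelSpace →L[ℝ] ℝ) →L[ℝ] ℝ => l y) h).symm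

theorem reduceDeriv_p (z : TStarQ) (y : ModelSpace × (ModelSpace →L[ℝ] ℝ)) :
    (reduceDeriv z y).2.2 = phaseCovector ((fibreCovector z).comp
      (coordDeriv openingField z.proj)) (openingField z.proj) y := by
  have h := hasMFDerivAt_unique (hasMFDerivAt_momentumFun_openingField z)
    (((ContinuousLinearMap.snd ℝ ℝ ℝ).comp (ContinuousLinearMap.snd ℝ E3 (ℝ × ℝ))).hasMFDerivAt.comp
      z (hasMFDerivAt_reduceVec z))
  exact (congrArg (fun l : ModelSpace × (ModelSpace →L[ℝ] ℝ) →L[ℝ] ℝ => l y) h).symm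

/-- The chain rule, in the form that `canonicalBracket_eq` takes as input. -/
theorem comp_reduceDeriv (z : TStarQ) (a : V →L[ℝ] ℝ) :
    a.comp (reduceDeriv z) = phaseCovector (pullbackBase z a) (pullbackFibre z.proj a) := by
  refine ContinuousLinearMap.ext fun y => ?_
  rw [ContinuousLinearMap.comp_apply, apply_V a]
  simp only [reduceDeriv_m, reduceDeriv_q, reduceDeriv_p]
  obtain ⟨b, η⟩ := y
  simp only [phaseCovector_apply, pullbackBase, pullbackFibre, Fin.sum_univ_three, add_apply,
    smul_apply, map_add, map_smul, smul_eq_mul, map_zero]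
  ring

theorem hasMFDerivAt_comp_reduceVec {f : V → ℝ} {z : TStarQ}
    (hf : DifferentiableAt ℝ f (reduceVec z)) :
    HasMFDerivAt modelTStarQ 𝓘(ℝ, ℝ) (fun z => f (reduceVec z)) z
      (phaseCovector (pullbackBase z (fderiv ℝ f (reduceVec z)))
        (pullbackFibre z.proj (fderiv ℝ f (reduceVec z)))) := by
  rw [← comp_reduceDeriv]
  exact hf.hasFDerivAt.hasMFDerivAt.comp z (hasMFDerivAt_reduceVec z)

theorem fibreCovector_frame_comm (z : TStarQ) (i j : Fin 3) :
    fibreCovector z (coordDeriv (frameField i) z.proj (frameField j z.proj)) -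
      fibreCovector z (coordDeriv (frameField j) z.proj (frameField i z.proj)) =
      -fibreCovector z (rotationField z.proj
        (cross (bodyFrame z.proj i) (bodyFrame z.proj j))) := by
  rw [← map_sub, coordDeriv_frameField_comm, map_neg]

theorem fibreCovector_opening_comm (z : TStarQ) (i : Fin 3) :
    fibreCovector z (coordDeriv (frameField i) z.proj (openingField z.proj)) -
      fibreCovector z (coordDeriv openingField z.proj (frameField i z.proj)) = 0 := by
  rw [← map_sub, coordDeriv_opening_comm, map_zero]

/-- The reduction map relates the brackets of all differentiable functions. -/
theorem canonicalBracket_comp_reduceMap {f h : V → ℝ} {z : TStarQ}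
    (hf : DifferentiableAt ℝ f (reduceVec z)) (hh : DifferentiableAt ℝ h (reduceVec z)) :
    canonicalBracket modelQ (fun z => f (reduceVec z)) (fun z => h (reduceVec z)) z =
      reducedBracket (fun y => f y.1) (fun y => h y.1) (reduceMap z) := by
  rw [canonicalBracket_eq (hasMFDerivAt_comp_reduceVec hf) (hasMFDerivAt_comp_reduceVec hh)]
  have df : ∀ v, dirDeriv (fun y => f y.1) (reduceMap z) v = fderiv ℝ f (reduceVec z) v :=
    fun v => dirDeriv_comp_val (y := reduceMap z) hf v
  have dh : ∀ v, dirDeriv (fun y => h y.1) (reduceMap z) v = fderiv ℝ h (reduceVec z) v :=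
    fun v => dirDeriv_comp_val (y := reduceMap z) hh v
  simp only [reducedBracket, gradM, df, dh]
  generalize fderiv ℝ f (reduceVec z) = a
  generalize fderiv ℝ h (reduceVec z) = b
  have h01 := fibreCovector_frame_comm z 0 1
  have h12 := fibreCovector_frame_comm z 1 2
  have h20 := fibreCovector_frame_comm z 2 0
  rw [cross_frame_zero_one] at h01
  rw [cross_frame_one_two] at h12
  rw [cross_frame_two_zero] at h20
  have h0 := fibreCovector_opening_comm z 0
  have h1 := fibreCovector_opening_comm z 1
  have h2 := fibreCovector_opening_comm z 2
  have q0 := fderiv_ambientAngle_rotation z.proj 0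
  have q1 := fderiv_ambientAngle_rotation z.proj 1
  have q2 := fderiv_ambientAngle_rotation z.proj 2
  have q3 := fderiv_ambientAngle_opening z.proj
  have em : ∀ i, (reduceMap z).1.1 i =
      fibreCovector z (rotationField z.proj (bodyFrame z.proj i)) := fun i => rfl
  simp only [inner_eq_sum, cross_apply_zero, cross_apply_one, cross_apply_two, em]
  simp only [pullbackBase, pullbackFibre, Fin.sum_univ_three, add_apply,
    smul_apply, map_add, map_smul, smul_eq_mul, ContinuousLinearMap.comp_apply,
    velocityModel_frameField, velocityModel_openingField, q0, q1, q2, q3]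
  generalize a (0, 1, 0) = aq, a (0, 0, 1) = ap, b (0, 1, 0) = bq, b (0, 0, 1) = bp
  generalize a (EuclideanSpace.single 0 1, 0, 0) = a0, a (EuclideanSpace.single 1 1, 0, 0) = a1,
    a (EuclideanSpace.single 2 1, 0, 0) = a2, b (EuclideanSpace.single 0 1, 0, 0) = b0,
    b (EuclideanSpace.single 1 1, 0, 0) = b1, b (EuclideanSpace.single 2 1, 0, 0) = b2
  -- By bilinearity each commutator relation enters with the `2 × 2` minor of the two gradients that
  -- belongs to its pair of coordinates. The `(q, p)` part has already been matched by `q0` to `q3`.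
  linear_combination (a0 * b1 - a1 * b0) * h01 + (a1 * b2 - a2 * b1) * h12 +
    (a2 * b0 - a0 * b2) * h20 + (a0 * bp - ap * b0) * h0 + (a1 * bp - ap * b1) * h1 +
    (a2 * bp - ap * b2) * h2

/-! ### The reduced bracket is a Poisson bracket -/

/-- `f` is differentiable at `y` and `c` is its derivative in the direction `v`. -/
def HasDirDeriv (f : ReducedSpace → ℝ) (y : ReducedSpace) (v : V) (c : ℝ) : Prop :=
  ∃ F : V → ℝ, (∀ y, f y = F y.1) ∧ DifferentiableAt ℝ F y.1 ∧ fderiv ℝ F y.1 v = c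

namespace HasDirDeriv

variable {f h : ReducedSpace → ℝ} {y : ReducedSpace} {v : V} {c d : ℝ}

theorem dirDeriv_eq (hf : HasDirDeriv f y v c) : dirDeriv f y v = c := by
  obtain ⟨F, hF, hd, rfl⟩ := hf
  rw [show f = fun y : ReducedSpace => F y.1 from funext hF, dirDeriv_comp_val hd]

theorem add (hf : HasDirDeriv f y v c) (hh : HasDirDeriv h y v d) :
    HasDirDeriv (fun y => f y + h y) y v (c + d) := by
  obtain ⟨F, hF, hd, rfl⟩ := hf
  obtain ⟨G, hG, hd', rfl⟩ := hh
  exact ⟨fun w => F w + G w, fun y => by simp only [hF, hG], hd.add hd', by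
    rw [fderiv_fun_add hd hd']; rfl⟩

theorem sub (hf : HasDirDeriv f y v c) (hh : HasDirDeriv h y v d) :
    HasDirDeriv (fun y => f y - h y) y v (c - d) := by
  obtain ⟨F, hF, hd, rfl⟩ := hf
  obtain ⟨G, hG, hd', rfl⟩ := hh
  exact ⟨fun w => F w - G w, fun y => by simp only [hF, hG], hd.sub hd', by
    rw [fderiv_fun_sub hd hd']; rfl⟩

theorem mul (hf : HasDirDeriv f y v c) (hh : HasDirDeriv h y v d) :
    HasDirDeriv (fun y => f y * h y) y v (f y * d + h y * c) := by
  obtain ⟨F, hF, hd, rfl⟩ := hf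
  obtain ⟨G, hG, hd', rfl⟩ := hh
  exact ⟨fun w => F w * G w, fun y => by simp only [hF, hG], hd.mul hd', by
    rw [fderiv_fun_mul hd hd', hF, hG]; rfl⟩

theorem const (c : ℝ) : HasDirDeriv (fun _ => c) y v 0 :=
  ⟨fun _ => c, fun _ => rfl, differentiableAt_const _, by simp⟩

end HasDirDeriv

theorem hasDirDeriv_of_clm (l : V →L[ℝ] ℝ) (y : ReducedSpace) (v : V) :
    HasDirDeriv (fun y => l y.1) y v (l v) :=
  ⟨l, fun _ => rfl, l.differentiableAt, by rw [l.fderiv]⟩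

theorem hasDirDeriv_mCoord (i : Fin 3) (y : ReducedSpace) (v : V) :
    HasDirDeriv (mCoord i) y v (v.1 i) :=
  hasDirDeriv_of_clm ((EuclideanSpace.proj i).comp (ContinuousLinearMap.fst ℝ E3 (ℝ × ℝ))) y v

theorem hasDirDeriv_qCoord (y : ReducedSpace) (v : V) : HasDirDeriv qCoord y v v.2.1 :=
  hasDirDeriv_of_clm
    ((ContinuousLinearMap.fst ℝ ℝ ℝ).comp (ContinuousLinearMap.snd ℝ E3 (ℝ × ℝ))) y v

theorem hasDirDeriv_pCoord (y : ReducedSpace) (v : V) : HasDirDeriv pCoord y v v.2.2 :=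
  hasDirDeriv_of_clm
    ((ContinuousLinearMap.snd ℝ ℝ ℝ).comp (ContinuousLinearMap.snd ℝ E3 (ℝ × ℝ))) y v

section Smooth

variable {f g h : ReducedSpace → ℝ}

theorem hasDirDeriv_dirDeriv (hf : SmoothFun 𝓘(ℝ, V) f) (y : ReducedSpace) (v : V) :
    HasDirDeriv f y v (dirDeriv f y v) := by
  have hd : DifferentiableAt ℝ (extendFun f) y.1 :=
    (contDiffAt_extendFun hf y).differentiableAt (by simp)
  refine ⟨extendFun f, fun y => (extendFun_val f y).symm, hd, ?_⟩
  rw [← dirDeriv_comp_val hd, extendFun_comp_val]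

theorem dirDeriv_eq_fderiv_extendFun (hf : SmoothFun 𝓘(ℝ, V) f) (y : ReducedSpace) (v : V) :
    dirDeriv f y v = fderiv ℝ (extendFun f) y.1 v := by
  rw [← dirDeriv_comp_val ((contDiffAt_extendFun hf y).differentiableAt (by simp)),
    extendFun_comp_val]

theorem smoothFun_dirDeriv (hf : SmoothFun 𝓘(ℝ, V) f) (v : V) :
    SmoothFun 𝓘(ℝ, V) (fun y => dirDeriv f y v) := by
  rw [show (fun y => dirDeriv f y v) = fun y : ReducedSpace => fderiv ℝ (extendFun f) y.1 v from
    funext fun y => dirDeriv_eq_fderiv_extendFun hf y v]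
  exact smoothFun_comp_val (f := fun w => fderiv ℝ (extendFun f) w v) fun y =>
    ((contDiffAt_extendFun hf y).fderiv_right (m := ∞) (by simp)).clm_apply contDiffAt_const

theorem dirDeriv_comm (hf : SmoothFun 𝓘(ℝ, V) f) (y : ReducedSpace) (v w : V) :
    dirDeriv (fun y => dirDeriv f y v) y w = dirDeriv (fun y => dirDeriv f y w) y v := by
  have hd : DifferentiableAt ℝ (fderiv ℝ (extendFun f)) y.1 :=
    ((contDiffAt_extendFun hf y).fderiv_right (m := ∞) (by simp)).differentiableAt (by simp)
  have key : ∀ v w, dirDeriv (fun y => dirDeriv f y v) y w =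
      fderiv ℝ (fderiv ℝ (extendFun f)) y.1 w v := by
    intro v w
    rw [show (fun y => dirDeriv f y v) = fun y : ReducedSpace => fderiv ℝ (extendFun f) y.1 v from
      funext fun y => dirDeriv_eq_fderiv_extendFun hf y v,
      dirDeriv_comp_val (f := fun u => fderiv ℝ (extendFun f) u v)
        (hd.clm_apply (differentiableAt_const v)),
      fderiv_clm_apply hd (differentiableAt_const v)]
    simp
  rw [key, key]
  exact (contDiffAt_extendFun hf y).isSymmSndFDerivAt
    (by simpa using WithTop.coe_le_coe.2 (le_top : (2 : ℕ∞) ≤ ⊤)) _ _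

end Smooth

/-- The coordinate vectors of `ℝ³ × ℝ × ℝ`. -/
noncomputable def coordVec : Fin 5 → V :=
  ![(EuclideanSpace.single 0 1, 0, 0), (EuclideanSpace.single 1 1, 0, 0),
    (EuclideanSpace.single 2 1, 0, 0), (0, 1, 0), (0, 0, 1)]

/-- The Lie-Poisson part of the reduced bracket at `m`, in terms of partial derivatives. -/
noncomputable def lieForm (m : Fin 3 → ℝ) (a b : Fin 5 → ℝ) : ℝ :=
  m 0 * (a 2 * b 1 - a 1 * b 2) + m 1 * (a 0 * b 2 - a 2 * b 0) + m 2 * (a 1 * b 0 - a 0 * b 1)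

/-- The reduced bracket at `m`, in terms of partial derivatives. -/
noncomputable def bracketForm (m : Fin 3 → ℝ) (a b : Fin 5 → ℝ) : ℝ :=
  lieForm m a b + (a 3 * b 4 - b 3 * a 4)

/-- The partial derivatives of a function on the reduced space. -/
noncomputable def partialDeriv (i : Fin 5) (f : ReducedSpace → ℝ) (y : ReducedSpace) : ℝ :=
  dirDeriv f y (coordVec i)

theorem reducedBracket_eq (f h : ReducedSpace → ℝ) (y : ReducedSpace) : reducedBracket f h y =
    (mCoord 0 y * (partialDeriv 2 f y * partialDeriv 1 h y -
        partialDeriv 1 f y * partialDeriv 2 h y) +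
      mCoord 1 y * (partialDeriv 0 f y * partialDeriv 2 h y -
        partialDeriv 2 f y * partialDeriv 0 h y) +
      mCoord 2 y * (partialDeriv 1 f y * partialDeriv 0 h y -
        partialDeriv 0 f y * partialDeriv 1 h y)) +
      (partialDeriv 3 f y * partialDeriv 4 h y - partialDeriv 3 h y * partialDeriv 4 f y) := by
  rw [reducedBracket, inner_eq_sum, cross_apply_zero, cross_apply_one, cross_apply_two]
  change -(mCoord 0 y * (partialDeriv 1 f y * partialDeriv 2 h y -
        partialDeriv 2 f y * partialDeriv 1 h y) +
      mCoord 1 y * (partialDeriv 2 f y * partialDeriv 0 h y -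
        partialDeriv 0 f y * partialDeriv 2 h y) +
      mCoord 2 y * (partialDeriv 0 f y * partialDeriv 1 h y -
        partialDeriv 1 f y * partialDeriv 0 h y)) +
      (partialDeriv 3 f y * partialDeriv 4 h y - partialDeriv 3 h y * partialDeriv 4 f y) = _
  ring

theorem partialDeriv_mCoord (i : Fin 5) (j : Fin 3) (y : ReducedSpace) :
    partialDeriv i (mCoord j) y = (coordVec i).1 j :=
  (hasDirDeriv_mCoord j y _).dirDeriv_eq

theorem partialDeriv_qCoord (i : Fin 5) (y : ReducedSpace) :
    partialDeriv i qCoord y = (coordVec i).2.1 :=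
  (hasDirDeriv_qCoord y _).dirDeriv_eq

theorem partialDeriv_pCoord (i : Fin 5) (y : ReducedSpace) :
    partialDeriv i pCoord y = (coordVec i).2.2 :=
  (hasDirDeriv_pCoord y _).dirDeriv_eq

theorem smoothFun_mCoord (i : Fin 3) : SmoothFun 𝓘(ℝ, V) (mCoord i) :=
  smoothFun_comp_val (f := (EuclideanSpace.proj i).comp (ContinuousLinearMap.fst ℝ E3 (ℝ × ℝ)))
    fun _ => ContinuousLinearMap.contDiff _ |>.contDiffAt

section Smooth

variable {f g h : ReducedSpace → ℝ}

theorem partialDeriv_comm (hf : SmoothFun 𝓘(ℝ, V) f) (y : ReducedSpace) (i j : Fin 5) :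
    partialDeriv i (partialDeriv j f) y = partialDeriv j (partialDeriv i f) y :=
  dirDeriv_comm hf y (coordVec j) (coordVec i)

theorem hasDirDeriv_partialDeriv (hf : SmoothFun 𝓘(ℝ, V) f) (y : ReducedSpace) (i j : Fin 5) :
    HasDirDeriv (partialDeriv i f) y (coordVec j) (partialDeriv j (partialDeriv i f) y) :=
  hasDirDeriv_dirDeriv (smoothFun_dirDeriv hf (coordVec i)) y _

theorem smoothFun_reducedBracket (hf : SmoothFun 𝓘(ℝ, V) f) (hh : SmoothFun 𝓘(ℝ, V) h) :
    SmoothFun 𝓘(ℝ, V) (reducedBracket f h) := by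
  have pf : ∀ i, SmoothFun 𝓘(ℝ, V) (partialDeriv i f) := fun i => smoothFun_dirDeriv hf _
  have ph : ∀ i, SmoothFun 𝓘(ℝ, V) (partialDeriv i h) := fun i => smoothFun_dirDeriv hh _
  have m := smoothFun_mCoord
  rw [show reducedBracket f h = _ from funext (reducedBracket_eq f h)]
  exact ((((m 0).mul (((pf 2).mul (ph 1)).sub ((pf 1).mul (ph 2)))).add
    ((m 1).mul (((pf 0).mul (ph 2)).sub ((pf 2).mul (ph 0))))).add
    ((m 2).mul (((pf 1).mul (ph 0)).sub ((pf 0).mul (ph 1))))).add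
    (((pf 3).mul (ph 4)).sub ((ph 3).mul (pf 4)))

/-- The product rule. The last term differentiates the coefficients, which are linear in `m`, so `m`
is replaced by its derivative, the `m`-part of the coordinate vector. -/
theorem partialDeriv_reducedBracket (hf : SmoothFun 𝓘(ℝ, V) f) (hh : SmoothFun 𝓘(ℝ, V) h)
    (y : ReducedSpace) (i : Fin 5) : partialDeriv i (reducedBracket f h) y =
      bracketForm (fun k => mCoord k y) (fun k => partialDeriv i (partialDeriv k f) y)
        (fun k => partialDeriv k h y) +
      bracketForm (fun k => mCoord k y) (fun k => partialDeriv k f y)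
        (fun k => partialDeriv i (partialDeriv k h) y) +
      lieForm (fun k => (coordVec i).1 k) (fun k => partialDeriv k f y)
        (fun k => partialDeriv k h y) := by
  have pf := fun k => hasDirDeriv_partialDeriv hf y k i
  have ph := fun k => hasDirDeriv_partialDeriv hh y k i
  have m := fun k => hasDirDeriv_mCoord k y (coordVec i)
  have := (((((m 0).mul (((pf 2).mul (ph 1)).sub ((pf 1).mul (ph 2)))).add
    ((m 1).mul (((pf 0).mul (ph 2)).sub ((pf 2).mul (ph 0))))).add
    ((m 2).mul (((pf 1).mul (ph 0)).sub ((pf 0).mul (ph 1))))).add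
    (((pf 3).mul (ph 4)).sub ((ph 3).mul (pf 4)))).dirDeriv_eq
  rw [← show reducedBracket f h = _ from funext (reducedBracket_eq f h)] at this
  refine this.trans ?_
  simp only [bracketForm, lieForm]
  ring

end Smooth

/-- The Jacobi identity for gradients `a, b, c` and Hessians `A, B, C`. The Hessian terms cancel by
symmetry, and what remains is the Jacobi identity of `so(3)`. -/
theorem bracketForm_jacobi (m : Fin 3 → ℝ) (a b c : Fin 5 → ℝ) (A B C : Fin 5 → Fin 5 → ℝ)
    (hA : ∀ i j, A i j = A j i) (hB : ∀ i j, B i j = B j i) (hC : ∀ i j, C i j = C j i) :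
    bracketForm m a (fun i => bracketForm m (B i) c + bracketForm m b (C i) +
      lieForm (fun k => (coordVec i).1 k) b c) +
    bracketForm m b (fun i => bracketForm m (C i) a + bracketForm m c (A i) +
      lieForm (fun k => (coordVec i).1 k) c a) +
    bracketForm m c (fun i => bracketForm m (A i) b + bracketForm m a (B i) +
      lieForm (fun k => (coordVec i).1 k) a b) = 0 := by
  simp only [bracketForm, lieForm, coordVec]
  simp only [Matrix.cons_val]
  simp
  -- Entries below the diagonal are replaced by those above it, so that `ring` sees one variable for
  -- each symmetric pair.
  rw [hA 1 0, hA 2 0, hA 3 0, hA 4 0, hA 2 1, hA 3 1, hA 4 1, hA 3 2, hA 4 2, hA 4 3,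
    hB 1 0, hB 2 0, hB 3 0, hB 4 0, hB 2 1, hB 3 1, hB 4 1, hB 3 2, hB 4 2, hB 4 3,
    hC 1 0, hC 2 0, hC 3 0, hC 4 0, hC 2 1, hC 3 1, hC 4 1, hC 3 2, hC 4 2, hC 4 3]
  ring

theorem reducedBracket_apply (f h : ReducedSpace → ℝ) (y : ReducedSpace) :
    reducedBracket f h y = bracketForm (fun k => mCoord k y) (fun k => partialDeriv k f y)
      (fun k => partialDeriv k h y) := by
  rw [reducedBracket_eq, bracketForm, lieForm]

theorem isPoissonBracket_reducedBracket : IsPoissonBracket 𝓘(ℝ, V) reducedBracket where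
  smooth _ _ hf hh := smoothFun_reducedBracket hf hh
  skew f h _ _ := by
    funext y
    rw [Pi.neg_apply, reducedBracket_eq, reducedBracket_eq]
    ring
  add_left f₁ f₂ h h₁ h₂ _ := by
    funext y
    have e : ∀ k, partialDeriv k (f₁ + f₂) y = partialDeriv k f₁ y + partialDeriv k f₂ y :=
      fun k => ((hasDirDeriv_dirDeriv h₁ y (coordVec k)).add
        (hasDirDeriv_dirDeriv h₂ y (coordVec k))).dirDeriv_eq
    simp only [Pi.add_apply, reducedBracket_eq, e]
    ring
  smul_left c f h hf _ := by
    funext y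
    have e : ∀ k, partialDeriv k (c • f) y = c * partialDeriv k f y := fun k => by
      have := ((HasDirDeriv.const c).mul (hasDirDeriv_dirDeriv hf y (coordVec k))).dirDeriv_eq
      rw [mul_zero, add_zero] at this
      exact this
    simp only [Pi.smul_apply, smul_eq_mul, reducedBracket_eq, e]
    ring
  leibniz f₁ f₂ h h₁ h₂ _ := by
    funext y
    have e : ∀ k, partialDeriv k (f₁ * f₂) y = f₁ y * partialDeriv k f₂ y +
        f₂ y * partialDeriv k f₁ y :=
      fun k => ((hasDirDeriv_dirDeriv h₁ y (coordVec k)).mul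
        (hasDirDeriv_dirDeriv h₂ y (coordVec k))).dirDeriv_eq
    simp only [Pi.add_apply, Pi.mul_apply, reducedBracket_eq, e]
    ring
  jacobi f₁ f₂ f₃ h₁ h₂ h₃ := by
    funext y
    simp only [Pi.add_apply, Pi.zero_apply]
    rw [reducedBracket_apply f₁, reducedBracket_apply f₂, reducedBracket_apply f₃]
    simp only [partialDeriv_reducedBracket h₂ h₃, partialDeriv_reducedBracket h₃ h₁,
      partialDeriv_reducedBracket h₁ h₂]
    exact bracketForm_jacobi _ _ _ _ (fun i k => partialDeriv i (partialDeriv k f₁) y)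
      (fun i k => partialDeriv i (partialDeriv k f₂) y)
      (fun i k => partialDeriv i (partialDeriv k f₃) y) (partialDeriv_comm h₁ y)
      (partialDeriv_comm h₂ y) (partialDeriv_comm h₃ y)

theorem reducedBracket_coordinates :
    reducedBracket (mCoord 0) (mCoord 1) = -mCoord 2 ∧
      reducedBracket (mCoord 1) (mCoord 2) = -mCoord 0 ∧
      reducedBracket (mCoord 2) (mCoord 0) = -mCoord 1 ∧
      reducedBracket qCoord pCoord = 1 ∧
      (∀ i, reducedBracket (mCoord i) qCoord = 0 ∧ reducedBracket (mCoord i) pCoord = 0) := by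
  refine ⟨?_, ?_, ?_, ?_, fun i => ⟨?_, ?_⟩⟩
  all_goals
    funext y
    rw [reducedBracket_eq]
    simp only [partialDeriv_mCoord, partialDeriv_qCoord, partialDeriv_pCoord]
    simp [coordVec]

/-- The gradient is `2m` in the `m` directions and zero in `(q, p)`, and `m` is orthogonal to `m ×
w` for every `w`. -/
theorem isCasimir_normSq : IsCasimir 𝓘(ℝ, V) reducedBracket (fun y => ‖y.1.1‖ ^ 2) := by
  have e : (fun y : ReducedSpace => ‖y.1.1‖ ^ 2) =
      fun y => mCoord 0 y * mCoord 0 y + mCoord 1 y * mCoord 1 y + mCoord 2 y * mCoord 2 y := by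
    funext y
    rw [← real_inner_self_eq_norm_sq, inner_eq_sum]
    rfl
  have m := smoothFun_mCoord
  refine ⟨?_, fun f _ => ?_⟩
  · rw [e]
    exact (((m 0).mul (m 0)).add ((m 1).mul (m 1))).add ((m 2).mul (m 2))
  · funext y
    have hd : ∀ k, partialDeriv k (fun y : ReducedSpace => ‖y.1.1‖ ^ 2) y =
        2 * (mCoord 0 y * (coordVec k).1 0 + mCoord 1 y * (coordVec k).1 1 +
          mCoord 2 y * (coordVec k).1 2) := fun k => by
      have n := fun i => hasDirDeriv_mCoord i y (coordVec k)
      rw [e]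
      refine ((((n 0).mul (n 0)).add ((n 1).mul (n 1))).add ((n 2).mul (n 2))).dirDeriv_eq.trans ?_
      ring
    rw [reducedBracket_eq]
    simp only [hd]
    simp [coordVec]
    ring

/-! ### Equivariance of the moving frame -/

theorem rot_add (g : SO3) (v w : E3) : rot g (v + w) = rot g v + rot g w := by simp [rot]

theorem rot_smul (g : SO3) (c : ℝ) (v : E3) : rot g (c • v) = c • rot g v := by simp [rot]

theorem inner_rot (g : SO3) (v w : E3) : ⟪rot g v, rot g w⟫_ℝ = ⟪v, w⟫_ℝ := by
  have h := norm_rot g (v + w)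
  have h1 := norm_add_sq_real v w
  have h2 := norm_add_sq_real (rot g v) (rot g w)
  rw [← rot_add, h, norm_rot, norm_rot] at h2
  linarith

theorem rot_apply (g : SO3) (v : E3) (i : Fin 3) :
    rot g v i = g.1 i 0 * v 0 + g.1 i 1 * v 1 + g.1 i 2 * v 2 := by
  simp [rot, Matrix.toEuclideanLin, Matrix.mulVec, dotProduct, Fin.sum_univ_three]

/-- The triple product is a determinant, hence is multiplied by `det g = 1`. Here orientation
matters: a reflection would reverse the sign. -/
theorem inner_rot_cross (g : SO3) (a b c : E3) :
    ⟪rot g a, cross (rot g b) (rot g c)⟫_ℝ = ⟪a, cross b c⟫_ℝ := by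
  have hdet : g.1.det = 1 := (Matrix.mem_specialOrthogonalGroup_iff.1 g.2).2
  have h : ⟪rot g a, cross (rot g b) (rot g c)⟫_ℝ = g.1.det * ⟪a, cross b c⟫_ℝ := by
    rw [Matrix.det_fin_three]
    simp only [inner_eq_sum, cross_apply_zero, cross_apply_one, cross_apply_two, rot_apply]
    ring
  rw [h, hdet, one_mul]

theorem rot_cross (g : SO3) (a b : E3) : rot g (cross a b) = cross (rot g a) (rot g b) := by
  refine ext_inner_left ℝ fun v => ?_
  have hv : v = rot g (rot g⁻¹ v) := by rw [← rot_mul, mul_inv_cancel, rot_one]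
  rw [hv, inner_rot, inner_rot_cross]

theorem angleQ_smul (g : SO3) (x : Q) : angleQ (g • x) = angleQ x := by
  have h := cos_angleQ (g • x)
  rw [R₁_smul, R₂_smul, inner_rot, ← cos_angleQ] at h
  exact Real.injOn_cos (Ioo_subset_Icc_self (angleQ_mem_Ioo _))
    (Ioo_subset_Icc_self (angleQ_mem_Ioo _)) h

theorem bodyFrame_smul (g : SO3) (x : Q) (i : Fin 3) :
    bodyFrame (g • x) i = rot g (bodyFrame x i) := by
  have h0 : bodyFrame (g • x) 0 = rot g (bodyFrame x 0) := by
    rw [bodyFrame_zero, bodyFrame_zero, angleQ_smul, R₁_smul, R₂_smul, rot_smul, rot_cross]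
  fin_cases i
  · exact h0
  · exact (congrArg (cross (R₁ (g • x))) h0).trans (rot_cross g _ _).symm
  · rfl

/-- The matrix whose columns are the vectors of the moving frame. -/
noncomputable def frameRotation (x : Q) : SO3 :=
  ⟨Matrix.of fun i j => bodyFrame x j i, by
    rw [Matrix.mem_specialOrthogonalGroup_iff, Matrix.mem_orthogonalGroup_iff']
    constructor
    · ext i j
      rw [Matrix.mul_apply, Fin.sum_univ_three, Matrix.one_apply, ← inner_bodyFrame x, inner_eq_sum]
      rfl
    · have h : ⟪bodyFrame x 0, cross (bodyFrame x 1) (bodyFrame x 2)⟫_ℝ = 1 := by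
        rw [cross_frame_one_two, inner_bodyFrame, if_pos rfl]
      rw [← h, Matrix.det_fin_three]
      simp only [inner_eq_sum, cross_apply_zero, cross_apply_one, cross_apply_two, Matrix.of_apply]
      ring⟩

theorem rot_frameRotation (x : Q) (i : Fin 3) :
    rot (frameRotation x) (EuclideanSpace.single i 1) = bodyFrame x i := by
  ext k
  rw [rot_apply]
  fin_cases i <;> simp [frameRotation]

/-- The rotation taking one moving frame to the other works, because the coordinates of both bodies
in the moving frame depend on the angle alone. -/
theorem exists_smul_eq {x y : Q} (h : angleQ x = angleQ y) : ∃ g : SO3, g • x = y := by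
  have key : ∀ i, rot (frameRotation y * (frameRotation x)⁻¹) (bodyFrame x i) = bodyFrame y i := by
    intro i
    rw [← rot_frameRotation x, ← rot_mul, inv_mul_cancel_right, rot_frameRotation]
  refine ⟨frameRotation y * (frameRotation x)⁻¹, ?_⟩
  apply Subtype.ext
  apply Prod.ext <;> apply Subtype.ext
  · exact key 2
  · change rot _ (R₂ x) = R₂ y
    rw [R₂_eq x, R₂_eq y, rot_add, rot_smul, rot_smul, key, key, h]

/-! ### Invariance of the reduction map -/

/-- The rotation of a pair of vectors. -/
noncomputable def rotPair (g : SO3) : E3 × E3 →L[ℝ] E3 × E3 :=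
  (LinearMap.toContinuousLinearMap (Matrix.toEuclideanLin (g : Matrix (Fin 3) (Fin 3) ℝ))).prodMap
    (LinearMap.toContinuousLinearMap (Matrix.toEuclideanLin (g : Matrix (Fin 3) (Fin 3) ℝ)))

theorem rotPair_apply (g : SO3) (w : E3 × E3) : rotPair g w = (rot g w.1, rot g w.2) := rfl

/-- The inclusion of `Q` into `ℝ³ × ℝ³` is equivariant, and the two ways of composing it with the
rotation have the same differential. -/
theorem velocityModel_dSmulModel (g : SO3) (x : Q) (v : ModelSpace) :
    velocityModel (g • x) (dSmulModel g x v) = rotPair g (velocityModel x v) := by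
  have h1 := (hasMFDerivAt_positions (g • x)).comp x (hasMFDerivAt_smul g x)
  have h2 := (rotPair g).hasMFDerivAt.comp x (hasMFDerivAt_positions x)
  exact congrArg (fun l : ModelSpace →L[ℝ] E3 × E3 => l v) (hasMFDerivAt_unique h1 h2)

theorem dSmulModel_frameField (g : SO3) (x : Q) (i : Fin 3) :
    dSmulModel g x (frameField i x) = frameField i (g • x) := by
  apply velocityModel_injective
  rw [velocityModel_dSmulModel, frameField, frameField, velocityModel_rotationField,
    velocityModel_rotationField, rotPair_apply, rot_cross, rot_cross, bodyFrame_smul]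
  rfl

theorem dSmulModel_openingField (g : SO3) (x : Q) :
    dSmulModel g x (openingField x) = openingField (g • x) := by
  apply velocityModel_injective
  rw [velocityModel_dSmulModel, velocityModel_openingField, velocityModel_openingField,
    rotPair_apply]
  change (rot g 0, rot g (cross (R₂ x) (bodyFrame x 0))) =
    ((0 : E3), cross (R₂ (g • x)) (bodyFrame (g • x) 0))
  rw [rot_cross, bodyFrame_smul, R₂_smul]
  simp [rot]

theorem fibreCovector_smul (g : SO3) (z : TStarQ) (v : ModelSpace) :
    fibreCovector (g • z) (dSmulModel g z.proj v) = fibreCovector z v := by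
  obtain ⟨e, he⟩ := dSmul_isInvertible g z.proj
  have h : fibreCovector (g • z) = (fibreCovector z).comp (dSmulModel g z.proj).inverse := rfl
  rw [h, ← he, ContinuousLinearMap.inverse_equiv]
  exact congrArg (fibreCovector z) (e.symm_apply_apply v)

theorem reduceVec_smul (g : SO3) (z : TStarQ) : reduceVec (g • z) = reduceVec z := by
  have h1 : ∀ i, momentumFun (frameField i) (g • z) = momentumFun (frameField i) z := fun i => by
    rw [momentumFun, momentumFun, ← fibreCovector_smul g z, dSmulModel_frameField]
    rfl
  have h2 : momentumFun openingField (g • z) = momentumFun openingField z := by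
    rw [momentumFun, momentumFun, ← fibreCovector_smul g z, dSmulModel_openingField]
    rfl
  have h3 : angleQ (g • z).proj = angleQ z.proj := angleQ_smul g z.proj
  rw [reduceVec, reduceVec, h2, h3]
  simp only [h1]

theorem momentumFun_eq_of_reduceVec_eq {z z' : TStarQ} (h : reduceVec z = reduceVec z') :
    (∀ i, momentumFun (frameField i) z = momentumFun (frameField i) z') ∧
      momentumFun openingField z = momentumFun openingField z' :=
  ⟨fun i => congrArg (fun v : V => v.1 i) h, congrArg (fun v : V => v.2.2) h⟩

theorem eq_of_reduceVec_eq {z z' : TStarQ} (hp : z.proj = z'.proj)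
    (h : reduceVec z = reduceVec z') : z = z' := by
  obtain ⟨h1, h2⟩ := momentumFun_eq_of_reduceVec_eq h
  obtain ⟨x, α⟩ := z
  obtain ⟨x', α'⟩ := z'
  obtain rfl : x = x' := hp
  exact congrArg (TotalSpace.mk x) (covector_ext (x := x) h1 h2)

/-- Equal angles give a rotation that matches the base points; by invariance the values on the frame
still agree, so the covectors coincide. -/
theorem reduceVec_eq_iff {z z' : TStarQ} :
    reduceVec z = reduceVec z' ↔ MulAction.orbitRel SO3 TStarQ z z' := by
  rw [MulAction.orbitRel_apply, MulAction.mem_orbit_iff]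
  constructor
  · intro h
    obtain ⟨g, hg⟩ := exists_smul_eq (x := z'.proj) (y := z.proj)
      (congrArg (fun v : V => v.2.1) h).symm
    exact ⟨g, eq_of_reduceVec_eq hg ((reduceVec_smul g z').trans h.symm)⟩
  · rintro ⟨g, rfl⟩
    exact reduceVec_smul g z'

/-- A configuration with prescribed angle. -/
theorem exists_angleQ_eq {q : ℝ} (hq : q ∈ Ioo 0 Real.pi) : ∃ x : Q, angleQ x = q := by
  have hs := Real.sin_pos_of_mem_Ioo hq
  let a : E3 := EuclideanSpace.single 2 1
  let b : E3 := !₂[0, Real.sin q, Real.cos q]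
  have ha : ‖a‖ = 1 := by simp [a]
  have hb : ‖b‖ = 1 := by
    rw [← sq_eq_sq₀ (norm_nonneg _) zero_le_one, ← real_inner_self_eq_norm_sq, inner_eq_sum]
    simp [b, ← sq]
  have hab : ⟪a, b⟫_ℝ = Real.cos q := by
    rw [inner_eq_sum]; simp [a, b]
  let x : Q := ⟨(⟨a, by simpa using ha⟩, ⟨b, by simpa using hb⟩), by
    constructor
    · intro h
      have := congrArg (fun v : E3 => v 1) h
      simp [a, b] at this
      exact hs.ne this
    · intro h
      have := congrArg (fun v : E3 => v 1) h
      simp [a, b] at this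
      exact hs.ne' this⟩
  refine ⟨x, Real.injOn_cos (Ioo_subset_Icc_self (angleQ_mem_Ioo _)) (Ioo_subset_Icc_self hq) ?_⟩
  rw [cos_angleQ]
  exact hab

theorem exists_reduceVec_eq {v : V} (hv : v.2.1 ∈ Ioo 0 Real.pi) : ∃ z, reduceVec z = v := by
  obtain ⟨x, hx⟩ := exists_angleQ_eq hv
  obtain ⟨α, h1, h2⟩ := exists_covector x v.1 v.2.2
  refine ⟨⟨x, α⟩, Prod.ext ?_ (Prod.ext hx h2)⟩
  ext i
  exact h1 i

/-! ### The reduction map is open -/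

/-- The system is triangular: a multiple `b` of the opening field produces the `q` component, and
then the momentum variation `η`, free to take any values on the frame, corrects `m` and `p` for the
contribution of `b`. -/
theorem reduceDeriv_surjective (z : TStarQ) : Function.Surjective (reduceDeriv z) := by
  intro v
  let b := v.2.1 • openingField z.proj
  obtain ⟨η, h1, h2⟩ := exists_covector z.proj
    (fun i => v.1 i - (fibreCovector z).comp (coordDeriv (frameField i) z.proj) b)
    (v.2.2 - (fibreCovector z).comp (coordDeriv openingField z.proj) b)
  refine ⟨(b, η), Prod.ext ?_ (Prod.ext ?_ ?_)⟩
  · ext i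
    rw [reduceDeriv_m, phaseCovector_apply, h1]
    ring
  · rw [reduceDeriv_q, phaseCovector_apply, map_zero, add_zero, ContinuousLinearMap.comp_apply,
      map_smul, map_smul, velocityModel_openingField, fderiv_ambientAngle_opening, smul_eq_mul,
      mul_one]
  · rw [reduceDeriv_p, phaseCovector_apply, h2]
    ring

/-- In a chart the map is strictly differentiable with surjective derivative, so it sends
neighbourhoods onto neighbourhoods. -/
theorem isOpenMap_reduceVec : IsOpenMap reduceVec := by
  rw [isOpenMap_iff_nhds_le]
  intro z
  have hc := contDiffAt_comp_extChartAt_symm contMDiff_reduceVec z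
  have hd := hasFDerivAt_comp_extChartAt_symm (hasMFDerivAt_reduceVec z)
  have hs := (hc.hasStrictFDerivAt (by simp)).map_nhds_eq_of_surj
    (by rw [hd.fderiv]; exact LinearMap.range_eq_top.2 (reduceDeriv_surjective z))
  rw [← map_extChartAt_nhds_of_boundaryless, Filter.map_map] at hs
  have e : (reduceVec ∘ (extChartAt modelTStarQ z).symm) ∘ extChartAt modelTStarQ z =ᶠ[nhds z]
      reduceVec := by
    filter_upwards [extChartAt_source_mem_nhds (I := modelTStarQ) z] with z' hz'
    rw [Function.comp_apply, Function.comp_apply, (extChartAt modelTStarQ z).left_inv hz']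
  rw [Filter.map_congr e, Function.comp_apply, extChartAt_to_inv] at hs
  exact hs.ge

/-! ### The orbit space -/

/-- The reduced coordinates on the orbit space, with values in `ℝ³ × ℝ × ℝ`. -/
noncomputable def orbitVec : OrbitSpace → V :=
  Quotient.lift reduceVec fun _ _ h => reduceVec_eq_iff.2 h

theorem orbitProj_surjective : Function.Surjective orbitProj := Quotient.mk_surjective

theorem continuous_orbitProj : Continuous orbitProj := continuous_quotient_mk'

theorem orbitVec_mem (w : OrbitSpace) : (orbitVec w).2.1 ∈ Ioo 0 Real.pi := by
  obtain ⟨z, rfl⟩ := orbitProj_surjective w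
  exact angleQ_mem_Ioo z.proj

/-- Injectivity says that the fibres of `reduceVec` are single orbits. Openness is inherited from
`reduceVec`, since an open set downstairs has the same image as its open preimage upstairs. -/
theorem isOpenEmbedding_orbitVec : Topology.IsOpenEmbedding orbitVec := by
  refine Topology.IsOpenEmbedding.of_continuous_injective_isOpenMap
    (contMDiff_reduceVec.continuous.quotient_lift _) ?_ fun s hs => ?_
  · intro w w' h
    obtain ⟨z, rfl⟩ := orbitProj_surjective w
    obtain ⟨z', rfl⟩ := orbitProj_surjective w'
    exact Quotient.sound (reduceVec_eq_iff.1 h)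
  · have e : orbitVec '' s = reduceVec '' (orbitProj ⁻¹' s) := by
      rw [← image_preimage_eq s orbitProj_surjective, image_image, preimage_image_preimage]
      rfl
    rw [e]
    exact isOpenMap_reduceVec _ (hs.preimage continuous_orbitProj)

theorem range_orbitVec : range orbitVec = {v | v.2.1 ∈ Ioo 0 Real.pi} := by
  ext v
  constructor
  · rintro ⟨w, rfl⟩
    exact orbitVec_mem w
  · intro hv
    obtain ⟨z, hz⟩ := exists_reduceVec_eq hv
    exact ⟨orbitProj z, hz⟩

instance instNonemptyOrbitSpace : Nonempty OrbitSpace :=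
  ⟨orbitProj (exists_reduceVec_eq (v := (0, Real.pi / 2, 0))
    ⟨by positivity, half_lt_self Real.pi_pos⟩).choose⟩

/-- The orbit space as a manifold: the reduced coordinates form a global chart. -/
@[reducible] noncomputable def orbitChartedSpace : ChartedSpace V OrbitSpace :=
  isOpenEmbedding_orbitVec.singletonChartedSpace

section OrbitManifold

attribute [local instance] orbitChartedSpace

theorem isManifold_orbitSpace : IsManifold 𝓘(ℝ, V) ∞ OrbitSpace :=
  isOpenEmbedding_orbitVec.isManifold_singleton

theorem contMDiff_orbitVec : ContMDiff 𝓘(ℝ, V) 𝓘(ℝ, V) ∞ orbitVec :=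
  contMDiff_isOpenEmbedding isOpenEmbedding_orbitVec

theorem contMDiff_orbitProj : ContMDiff modelTStarQ 𝓘(ℝ, V) ∞ orbitProj :=
  ContMDiff.of_comp_isOpenEmbedding isOpenEmbedding_orbitVec contMDiff_reduceVec

/-- The bijection between the orbit space and the reduced space. -/
noncomputable def orbitEquiv : OrbitSpace ≃ ReducedSpace :=
  Equiv.ofBijective (fun w => ⟨orbitVec w, orbitVec_mem w⟩)
    ⟨fun _ _ h => isOpenEmbedding_orbitVec.injective (congrArg Subtype.val h), fun y => by
      obtain ⟨w, hw⟩ : y.1 ∈ range orbitVec := by rw [range_orbitVec]; exact y.2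
      exact ⟨w, Subtype.ext hw⟩⟩

/-- The diffeomorphism between the orbit space and the reduced space. -/
noncomputable def orbitDiffeomorph : Diffeomorph 𝓘(ℝ, V) 𝓘(ℝ, V) OrbitSpace ReducedSpace ∞ where
  toEquiv := orbitEquiv
  contMDiff_toFun := contMDiff_of_opens_val contMDiff_orbitVec
  contMDiff_invFun := by
    refine ContMDiff.of_comp_isOpenEmbedding isOpenEmbedding_orbitVec ?_
    have e : orbitVec ∘ orbitEquiv.symm = Subtype.val := by
      funext y
      exact congrArg Subtype.val (orbitEquiv.apply_symm_apply y)
    exact e ▸ contMDiff_subtype_val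

/-- The surjective differential of `reduceVec` factors as `A ∘ B` through that of the projection,
`B`. The factor `A` is then a surjective endomorphism of a finite-dimensional space, hence
injective, and so `B` is surjective. -/
theorem isSmoothSubmersion_orbitProj : IsSmoothSubmersion modelTStarQ 𝓘(ℝ, V) orbitProj := by
  refine ⟨contMDiff_orbitProj, fun z => ?_⟩
  have hp := (contMDiff_orbitProj.mdifferentiable (by simp) z).hasMFDerivAt
  have hv := (contMDiff_orbitVec.mdifferentiable (by simp) (orbitProj z)).hasMFDerivAt
  have h := hasMFDerivAt_unique (hasMFDerivAt_reduceVec z) (hv.comp z hp)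
  let A : V →L[ℝ] V := mfderiv 𝓘(ℝ, V) 𝓘(ℝ, V) orbitVec (orbitProj z)
  let B : ModelSpace × (ModelSpace →L[ℝ] ℝ) →L[ℝ] V := mfderiv modelTStarQ 𝓘(ℝ, V) orbitProj z
  have hAB : ∀ y, A (B y) = reduceDeriv z y := fun y =>
    (congrArg (fun l : ModelSpace × (ModelSpace →L[ℝ] ℝ) →L[ℝ] V => l y) h).symm
  have hA : Function.Surjective A := fun v => by
    obtain ⟨y, hy⟩ := reduceDeriv_surjective z v
    exact ⟨B y, (hAB y).trans hy⟩
  have hA' : Function.Injective A :=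
    (LinearMap.injective_iff_surjective (f := (A : V →ₗ[ℝ] V))).2 hA
  intro v
  obtain ⟨y, hy⟩ := reduceDeriv_surjective z (A v)
  exact ⟨y, hA' ((hAB y).trans hy)⟩

/-- The reduced bracket, transported to the orbit space. -/
noncomputable def orbitBracket (f h : OrbitSpace → ℝ) (w : OrbitSpace) : ℝ :=
  reducedBracket (f ∘ orbitDiffeomorph.symm) (h ∘ orbitDiffeomorph.symm) (orbitDiffeomorph w)

theorem orbitBracket_eq (f h : OrbitSpace → ℝ) : orbitBracket f h =
    reducedBracket (f ∘ orbitDiffeomorph.symm) (h ∘ orbitDiffeomorph.symm) ∘ orbitDiffeomorph := rfl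

theorem comp_orbitDiffeomorph_comp_symm (f : ReducedSpace → ℝ) :
    (f ∘ orbitDiffeomorph) ∘ orbitDiffeomorph.symm = f :=
  funext fun y => congrArg f (orbitDiffeomorph.apply_symm_apply y)

theorem isPoissonBracket_orbitBracket : IsPoissonBracket 𝓘(ℝ, V) orbitBracket := by
  have s : ∀ {f : OrbitSpace → ℝ}, SmoothFun 𝓘(ℝ, V) f →
      SmoothFun 𝓘(ℝ, V) (f ∘ orbitDiffeomorph.symm) := fun hf =>
    hf.comp orbitDiffeomorph.symm.contMDiff
  have P := isPoissonBracket_reducedBracket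
  refine ⟨fun f h hf hh => ?_, fun f h hf hh => ?_, fun f₁ f₂ h h₁ h₂ hh => ?_,
    fun c f h hf hh => ?_, fun f₁ f₂ h h₁ h₂ hh => ?_, fun f₁ f₂ f₃ h₁ h₂ h₃ => ?_⟩
  · exact (P.smooth _ _ (s hf) (s hh)).comp orbitDiffeomorph.contMDiff
  · funext w
    exact congrFun (P.skew _ _ (s hf) (s hh)) _
  · funext w
    exact congrFun (P.add_left _ _ _ (s h₁) (s h₂) (s hh)) _
  · funext w
    exact congrFun (P.smul_left c _ _ (s hf) (s hh)) _
  · funext w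
    have := congrFun (P.leibniz _ _ _ (s h₁) (s h₂) (s hh)) (orbitDiffeomorph w)
    refine this.trans ?_
    simp [orbitBracket_eq]
  · funext w
    have := congrFun (P.jacobi _ _ _ (s h₁) (s h₂) (s h₃)) (orbitDiffeomorph w)
    refine Eq.trans ?_ this
    simp only [orbitBracket_eq, comp_orbitDiffeomorph_comp_symm, Pi.add_apply, Function.comp_apply]

theorem canonicalBracket_comp_of_smooth {f h : ReducedSpace → ℝ} (hf : SmoothFun 𝓘(ℝ, V) f)
    (hh : SmoothFun 𝓘(ℝ, V) h) (z : TStarQ) :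
    canonicalBracket modelQ (f ∘ reduceMap) (h ∘ reduceMap) z =
      reducedBracket f h (reduceMap z) := by
  have := canonicalBracket_comp_reduceMap (z := z)
    ((contDiffAt_extendFun hf (reduceMap z)).differentiableAt (by simp))
    ((contDiffAt_extendFun hh (reduceMap z)).differentiableAt (by simp))
  rw [extendFun_comp_val, extendFun_comp_val] at this
  rw [← this]
  congr 1 <;> funext z <;> exact (extendFun_val _ (reduceMap z)).symm

theorem isPoissonMap_orbitProj :
    IsPoissonMap modelTStarQ 𝓘(ℝ, V) (canonicalBracket modelQ) orbitBracket orbitProj := by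
  refine ⟨contMDiff_orbitProj, fun f h hf hh z => ?_⟩
  have e : ∀ f : OrbitSpace → ℝ, f ∘ orbitProj = (f ∘ orbitDiffeomorph.symm) ∘ reduceMap := by
    intro f
    funext z
    exact congrArg f (orbitDiffeomorph.symm_apply_apply (orbitProj z)).symm
  rw [e f, e h, canonicalBracket_comp_of_smooth (hf.comp orbitDiffeomorph.symm.contMDiff)
    (hh.comp orbitDiffeomorph.symm.contMDiff)]
  rfl

theorem isPoissonMap_orbitDiffeomorph :
    IsPoissonMap 𝓘(ℝ, V) 𝓘(ℝ, V) orbitBracket reducedBracket orbitDiffeomorph := by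
  refine ⟨orbitDiffeomorph.contMDiff, fun f h _ _ w => ?_⟩
  rw [orbitBracket, comp_orbitDiffeomorph_comp_symm, comp_orbitDiffeomorph_comp_symm]

end OrbitManifold

/-! ### The coordinates of the reduction map -/

/-- A tangent vector is determined by its velocity, so `v` is the rotation field of `ξ`; this field
is linear in `ξ`, and its values under the covector at the frame vectors are the `m_i`. -/
theorem rotation_apply_eq (z : TStarQ) (ξ : E3) (v : TangentSpace modelQ z.proj)
    (hv : velocity z.proj v = (cross ξ (R₁ z.proj), cross ξ (R₂ z.proj))) :
    (z.2 v : ℝ) = ∑ i, mCoord i (reduceMap z) * ⟪bodyFrame z.proj i, ξ⟫_ℝ := by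
  have h : v = rotationField z.proj ξ := by
    apply velocityModel_injective z.proj
    rw [velocityModel_rotationField]
    exact hv
  have h' : fibreCovector z (rotationField z.proj ξ) =
      ∑ i, mCoord i (reduceMap z) * ⟪bodyFrame z.proj i, ξ⟫_ℝ := by
    rw [rotationField_eq_sum, map_sum]
    refine Finset.sum_congr rfl fun i _ => ?_
    rw [map_smul, smul_eq_mul, mul_comm]
    rfl
  rw [h]
  exact h'

theorem opening_apply_eq (z : TStarQ) (v : TangentSpace modelQ z.proj)
    (hv : velocity z.proj v = (0, Real.cos (angleQ z.proj) • bodyFrame z.proj 1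
      - Real.sin (angleQ z.proj) • bodyFrame z.proj 2)) :
    (z.2 v : ℝ) = pCoord (reduceMap z) := by
  have h : v = openingField z.proj := by
    apply velocityModel_injective z.proj
    rw [velocityModel_openingField]
    refine Eq.trans hv ?_
    rw [← cross_R₂_frame_zero]
    rfl
  rw [h]
  rfl

/-! ### The reduced Hamiltonian -/

/-- The velocity of a motion, in the moving frame. -/
theorem velocityModel_eq_frame (x : Q) (a b c d : ℝ) :
    velocityModel x (a • frameField 0 x + b • frameField 1 x + c • frameField 2 x +
        d • openingField x) =
      (b • bodyFrame x 0 - a • bodyFrame x 1,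
        (b * Real.cos (angleQ x) - c * Real.sin (angleQ x)) • bodyFrame x 0 +
        ((d - a) * Real.cos (angleQ x)) • bodyFrame x 1 -
        ((d - a) * Real.sin (angleQ x)) • bodyFrame x 2) := by
  simp only [map_add, map_smul, velocityModel_frameField, velocityModel_openingField]
  change a • (cross (bodyFrame x 0) (bodyFrame x 2), cross (bodyFrame x 0) (R₂ x)) +
    b • (cross (bodyFrame x 1) (bodyFrame x 2), cross (bodyFrame x 1) (R₂ x)) +
    c • (cross (bodyFrame x 2) (bodyFrame x 2), cross (bodyFrame x 2) (R₂ x)) +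
    d • ((0 : E3), cross (R₂ x) (bodyFrame x 0)) = _
  rw [cross_anticomm (bodyFrame x 0) (R₂ x), cross_R₂_frame_zero]
  simp only [R₂_eq, cross_add_right, cross_smul_right, cross_self, cross_frame_zero_two,
    cross_frame_one_two, cross_frame_two_one]
  refine Prod.ext ?_ ?_
  · simp only [Prod.fst_add, Prod.smul_fst]
    module
  · simp only [Prod.snd_add, Prod.smul_snd]
    module

theorem exists_eq_frame (x : Q) (w : ModelSpace) : ∃ a b c d : ℝ,
    w = a • frameField 0 x + b • frameField 1 x + c • frameField 2 x + d • openingField x := by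
  have h := (tangentBasis x).sum_repr w
  rw [Fintype.sum_option, Fin.sum_univ_three] at h
  simp only [tangentBasis_some, tangentBasis_none] at h
  exact ⟨_, _, _, _, h.symm.trans (add_comm _ _)⟩

theorem inner_frame_combination (x : Q) (a b c a' b' c' : ℝ) :
    ⟪a • bodyFrame x 0 + b • bodyFrame x 1 - c • bodyFrame x 2,
      a' • bodyFrame x 0 + b' • bodyFrame x 1 - c' • bodyFrame x 2⟫_ℝ =
      a * a' + b * b' + c * c' := by
  simp only [inner_add_left, inner_add_right, inner_sub_left, inner_sub_right,
    real_inner_smul_left, real_inner_smul_right, inner_bodyFrame]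
  simp
  ring

theorem inner_velocityModel_fst (x : Q) (a b c d a' b' c' d' : ℝ) :
    ⟪(velocityModel x (a • frameField 0 x + b • frameField 1 x + c • frameField 2 x +
        d • openingField x)).1,
      (velocityModel x (a' • frameField 0 x + b' • frameField 1 x + c' • frameField 2 x +
        d' • openingField x)).1⟫_ℝ = a * a' + b * b' := by
  have h := inner_frame_combination x b (-a) 0 b' (-a') 0
  simp only [neg_smul, zero_smul, sub_zero, ← sub_eq_add_neg] at h
  rw [velocityModel_eq_frame, velocityModel_eq_frame, h]
  ring

theorem inner_velocityModel_snd (x : Q) (a b c d a' b' c' d' : ℝ) :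
    ⟪(velocityModel x (a • frameField 0 x + b • frameField 1 x + c • frameField 2 x +
        d • openingField x)).2,
      (velocityModel x (a' • frameField 0 x + b' • frameField 1 x + c' • frameField 2 x +
        d' • openingField x)).2⟫_ℝ =
      (b * Real.cos (angleQ x) - c * Real.sin (angleQ x)) *
        (b' * Real.cos (angleQ x) - c' * Real.sin (angleQ x)) + (d - a) * (d' - a') := by
  rw [velocityModel_eq_frame, velocityModel_eq_frame, inner_frame_combination]
  linear_combination ((d - a) * (d' - a')) * Real.sin_sq_add_cos_sq (angleQ x)

/-- The function on `ℝ³ × ℝ × ℝ` that extends the reduced Hamiltonian. -/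
noncomputable def reducedHamiltonianVec (μ₁ μ₂ : ℝ) (U : ℝ → ℝ) (v : V) : ℝ :=
  1 / (2 * μ₁) * (v.1 0 ^ 2 + v.1 1 ^ 2 + 2 * (Real.cos v.2.1 / Real.sin v.2.1) * v.1 1 * v.1 2 +
    (μ₁ / μ₂ + Real.cos v.2.1 ^ 2) / Real.sin v.2.1 ^ 2 * v.1 2 ^ 2 +
    2 * v.1 0 * v.2.2 + (1 + μ₁ / μ₂) * v.2.2 ^ 2) + U v.2.1

theorem reducedHamiltonian_eq (μ₁ μ₂ : ℝ) (U : ℝ → ℝ) (y : ReducedSpace) :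
    reducedHamiltonian μ₁ μ₂ U y = reducedHamiltonianVec μ₁ μ₂ U y.1 := by
  simp only [reducedHamiltonian, reducedHamiltonianVec, matA, Matrix.mulVec, dotProduct,
    Fin.sum_univ_three]
  simp
  left
  ring

theorem differentiableAt_reducedHamiltonianVec (μ₁ μ₂ : ℝ) {U : ℝ → ℝ}
    (hU : DifferentiableOn ℝ U (Ioo 0 Real.pi)) (y : ReducedSpace) :
    DifferentiableAt ℝ (reducedHamiltonianVec μ₁ μ₂ U) y.1 := by
  have hs : Real.sin y.1.2.1 ≠ 0 := (Real.sin_pos_of_mem_Ioo y.2).ne'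
  have hU' : DifferentiableAt ℝ (fun v : V => U v.2.1) y.1 :=
    DifferentiableAt.comp (g := U) y.1 (hU.differentiableAt (isOpen_Ioo.mem_nhds y.2))
      (by fun_prop)
  unfold reducedHamiltonianVec
  refine DifferentiableAt.add ?_ hU'
  have h0 : DifferentiableAt ℝ (fun v : V => v.1 0) y.1 := by fun_prop
  have h1 : DifferentiableAt ℝ (fun v : V => v.1 1) y.1 := by fun_prop
  have h2 : DifferentiableAt ℝ (fun v : V => v.1 2) y.1 := by fun_prop
  have hc : DifferentiableAt ℝ (fun v : V => Real.cos v.2.1) y.1 := by fun_prop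
  have hsin : DifferentiableAt ℝ (fun v : V => Real.sin v.2.1) y.1 := by fun_prop
  have hp : DifferentiableAt ℝ (fun v : V => v.2.2) y.1 := by fun_prop
  have h3 : DifferentiableAt ℝ (fun v : V => (μ₁ / μ₂ + Real.cos v.2.1 ^ 2) / Real.sin v.2.1 ^ 2)
      y.1 := by
    have hN : DifferentiableAt ℝ (fun v : V => μ₁ / μ₂ + Real.cos v.2.1 ^ 2) y.1 :=
      (hc.fun_pow 2).const_add _
    have hD : DifferentiableAt ℝ (fun v : V => Real.sin v.2.1 ^ 2) y.1 := hsin.fun_pow 2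
    simp only [div_eq_mul_inv (_ + _)]
    exact hN.fun_mul (hD.fun_inv (pow_ne_zero 2 hs))
  have h4 : DifferentiableAt ℝ (fun v : V => Real.cos v.2.1 / Real.sin v.2.1) y.1 := by
    simp only [div_eq_mul_inv]
    exact hc.fun_mul (hsin.fun_inv hs)
  exact ((((((h0.pow 2).add (h1.pow 2)).add (((h4.const_mul 2).mul h1).mul h2)).add
    (h3.mul (h2.pow 2))).add
    ((h0.const_mul 2).mul hp)).add ((hp.pow 2).const_mul (1 + μ₁ / μ₂))).const_mul (1 / (2 * μ₁))

/-- The supremum is attained at the velocity whose momentum is the given covector, so it suffices to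
exhibit this velocity and evaluate its kinetic energy. The potential `0` isolates the kinetic part.
-/
theorem cotangentKineticEnergy_eq_reduced {μ₁ μ₂ : ℝ} (h₁ : 0 < μ₁) (h₂ : 0 < μ₂) (z : TStarQ) :
    cotangentKineticEnergy μ₁ μ₂ z = reducedHamiltonianVec μ₁ μ₂ 0 (reduceVec z) := by
  have hs := (sin_angleQ_pos z.proj).ne'
  have hcs := Real.sin_sq_add_cos_sq (angleQ z.proj)
  have h₁' := h₁.ne'
  have h₂' := h₂.ne'
  let m : Fin 3 → ℝ := fun i => momentumFun (frameField i) z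
  let p : ℝ := momentumFun openingField z
  -- With `s = b cos q - c sin q`, the momentum equations are `m_x = μ₁ a - μ₂ (d - a)`, `m_y = μ₁ b
  -- + μ₂ s cos q`, `m_z = -μ₂ s sin q` and `p = μ₂ (d - a)`. The values of `a, b, c, d` are the
  -- solution; `hc` records `s`.
  let a : ℝ := (m 0 + p) / μ₁
  let b : ℝ := (m 1 + Real.cos (angleQ z.proj) * m 2 / Real.sin (angleQ z.proj)) / μ₁
  let c : ℝ := (b * Real.cos (angleQ z.proj) + m 2 / (Real.sin (angleQ z.proj) * μ₂)) /
    Real.sin (angleQ z.proj)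
  let d : ℝ := p / μ₂ + a
  have hc : b * Real.cos (angleQ z.proj) - c * Real.sin (angleQ z.proj) =
      -(m 2 / (Real.sin (angleQ z.proj) * μ₂)) := by
    simp only [c]
    field_simp
    ring
  let v : ModelSpace := a • frameField 0 z.proj + b • frameField 1 z.proj +
    c • frameField 2 z.proj + d • openingField z.proj
  have hv : IsMomentumOf μ₁ μ₂ z.proj z.2 v := by
    intro w
    obtain ⟨a', b', c', d', hw⟩ := exists_eq_frame z.proj w
    have e1 := inner_velocityModel_fst z.proj a b c d a' b' c' d'
    have e2 := inner_velocityModel_snd z.proj a b c d a' b' c' d'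
    rw [← hw] at e1 e2
    rw [hc] at e2
    have e3 : fibreCovector z w = a' * m 0 + b' * m 1 + c' * m 2 + d' * p := by
      rw [hw]
      simp only [map_add, map_smul, smul_eq_mul]
      rfl
    refine e3.trans (Eq.trans ?_ (congrArg₂ (fun s t => μ₁ * s + μ₂ * t) e1 e2).symm)
    simp only [d, add_sub_cancel_right, a, b]
    field_simp
    ring
  rw [TwoBody.cotangentKineticEnergy_eq h₁ h₂ z v hv]
  have e1 := inner_velocityModel_fst z.proj a b c d a b c d
  have e2 := inner_velocityModel_snd z.proj a b c d a b c d
  rw [real_inner_self_eq_norm_sq] at e1 e2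
  rw [hc] at e2
  refine (congrArg₂ (fun s t => (μ₁ * s + μ₂ * t) / 2) e1 e2).trans ?_
  change _ = 1 / (2 * μ₁) * (m 0 ^ 2 + m 1 ^ 2 + 2 * (Real.cos (angleQ z.proj) /
    Real.sin (angleQ z.proj)) * m 1 * m 2 + (μ₁ / μ₂ + Real.cos (angleQ z.proj) ^ 2) /
    Real.sin (angleQ z.proj) ^ 2 * m 2 ^ 2 + 2 * m 0 * p + (1 + μ₁ / μ₂) * p ^ 2) + 0
  simp only [d, add_sub_cancel_right, a, b]
  field_simp
  ring

theorem hamiltonian_eq {μ₁ μ₂ : ℝ} (h₁ : 0 < μ₁) (h₂ : 0 < μ₂) (U : ℝ → ℝ) (z : TStarQ) :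
    hamiltonian μ₁ μ₂ U z = reducedHamiltonian μ₁ μ₂ U (reduceMap z) := by
  rw [hamiltonian, cotangentKineticEnergy_eq_reduced h₁ h₂, reducedHamiltonian_eq,
    reducedHamiltonianVec, reducedHamiltonianVec, Pi.zero_apply, add_zero]
  rfl

/-- The Hamiltonian may fail to be smooth, so the Poisson map property on smooth functions does not
apply; the version for differentiable functions does. -/
theorem canonicalBracket_comp_hamiltonian {μ₁ μ₂ : ℝ} (h₁ : 0 < μ₁) (h₂ : 0 < μ₂) {U : ℝ → ℝ}
    (hU : DifferentiableOn ℝ U (Ioo 0 Real.pi)) {f : ReducedSpace → ℝ}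
    (hf : SmoothFun 𝓘(ℝ, V) f) (z : TStarQ) :
    canonicalBracket modelQ (f ∘ reduceMap) (hamiltonian μ₁ μ₂ U) z =
      reducedBracket f (reducedHamiltonian μ₁ μ₂ U) (reduceMap z) := by
  have h := canonicalBracket_comp_reduceMap (z := z)
    ((contDiffAt_extendFun hf (reduceMap z)).differentiableAt (by simp))
    (differentiableAt_reducedHamiltonianVec μ₁ μ₂ hU (reduceMap z))
  have e1 : (fun z => extendFun f (reduceVec z)) = f ∘ reduceMap :=
    funext fun z => extendFun_val _ (reduceMap z)
  have e2 : (fun z => reducedHamiltonianVec μ₁ μ₂ U (reduceVec z)) = hamiltonian μ₁ μ₂ U :=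
    funext fun z => ((hamiltonian_eq h₁ h₂ U z).trans (reducedHamiltonian_eq μ₁ μ₂ U _)).symm
  have e3 : (fun y : ReducedSpace => reducedHamiltonianVec μ₁ μ₂ U y.1) =
    reducedHamiltonian μ₁ μ₂ U := funext fun y => (reducedHamiltonian_eq μ₁ μ₂ U y).symm
  rwa [extendFun_comp_val, e1, e2, e3] at h

end TwoBody

theorem mainTheorem7 :
    -- the reduced bracket is a Poisson structure, given by the stated relations, with Casimir `|m|²`
    (IsPoissonBracket 𝓘(ℝ, V) reducedBracket ∧
      reducedBracket (mCoord 0) (mCoord 1) = -mCoord 2 ∧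
      reducedBracket (mCoord 1) (mCoord 2) = -mCoord 0 ∧
      reducedBracket (mCoord 2) (mCoord 0) = -mCoord 1 ∧
      reducedBracket qCoord pCoord = 1 ∧
      (∀ i, reducedBracket (mCoord i) qCoord = 0 ∧ reducedBracket (mCoord i) pCoord = 0) ∧
      IsCasimir 𝓘(ℝ, V) reducedBracket (fun y => ‖y.1.1‖ ^ 2)) ∧
    -- `T*Q / SO(3)` is a manifold and carries a Poisson bracket that makes the projection a
    -- Poisson submersion
    ∃ (_ : ChartedSpace V OrbitSpace) (br : (OrbitSpace → ℝ) → (OrbitSpace → ℝ) → OrbitSpace → ℝ),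
      IsManifold 𝓘(ℝ, V) ∞ OrbitSpace ∧
      IsSmoothSubmersion modelTStarQ 𝓘(ℝ, V) orbitProj ∧
      IsPoissonBracket 𝓘(ℝ, V) br ∧
      IsPoissonMap modelTStarQ 𝓘(ℝ, V) (canonicalBracket modelQ) br orbitProj ∧
      -- a Poisson isomorphism `Ψ` to `ℝ³ × (0, π) × ℝ`
      ∃ Ψ : Diffeomorph 𝓘(ℝ, V) 𝓘(ℝ, V) OrbitSpace ReducedSpace ∞,
        IsPoissonMap 𝓘(ℝ, V) 𝓘(ℝ, V) br reducedBracket Ψ ∧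
        -- `q` is the angle, `m` the angular momentum in the moving frame, `p` conjugate to `q`
        (∀ z : TStarQ, qCoord (Ψ (orbitProj z)) = angleQ z.proj) ∧
        (∀ (z : TStarQ) (ξ : E3) (v : TangentSpace modelQ z.proj),
          velocity z.proj v = (cross ξ (R₁ z.proj), cross ξ (R₂ z.proj)) →
          (z.2 v : ℝ) = ∑ i, mCoord i (Ψ (orbitProj z)) * ⟪bodyFrame z.proj i, ξ⟫_ℝ) ∧
        (∀ (z : TStarQ) (v : TangentSpace modelQ z.proj),
          velocity z.proj v = (0, Real.cos (angleQ z.proj) • bodyFrame z.proj 1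
            - Real.sin (angleQ z.proj) • bodyFrame z.proj 2) →
          (z.2 v : ℝ) = pCoord (Ψ (orbitProj z))) ∧
        -- the Hamiltonian and the dynamics reduce to those of the reduced Hamiltonian
        ∀ (μ₁ μ₂ : ℝ), 0 < μ₁ → 0 < μ₂ → ∀ U : ℝ → ℝ,
          (∀ z, hamiltonian μ₁ μ₂ U z = reducedHamiltonian μ₁ μ₂ U (Ψ (orbitProj z))) ∧
          (DifferentiableOn ℝ U (Set.Ioo 0 Real.pi) →
            (∀ f, SmoothFun 𝓘(ℝ, V) f → ∀ z,
              canonicalBracket modelQ (f ∘ Ψ ∘ orbitProj) (hamiltonian μ₁ μ₂ U) z =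
                reducedBracket f (reducedHamiltonian μ₁ μ₂ U) (Ψ (orbitProj z))) ∧
            ∀ (J : Set ℝ) (γ : ℝ → TStarQ),
              IsHamiltonianTrajectory modelTStarQ (canonicalBracket modelQ)
                (hamiltonian μ₁ μ₂ U) J γ →
              IsHamiltonianTrajectory 𝓘(ℝ, V) reducedBracket
                (reducedHamiltonian μ₁ μ₂ U) J (fun t => Ψ (orbitProj (γ t)))) := by
  -- `orbitDiffeomorph (orbitProj z)` unfolds to `reduceMap z`, so statements about the reduction
  -- map apply verbatim.
  refine ⟨⟨isPoissonBracket_reducedBracket, ?_⟩, orbitChartedSpace, orbitBracket,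
    isManifold_orbitSpace, isSmoothSubmersion_orbitProj, isPoissonBracket_orbitBracket,
    isPoissonMap_orbitProj, orbitDiffeomorph, isPoissonMap_orbitDiffeomorph, fun _ => rfl,
    rotation_apply_eq, opening_apply_eq, fun μ₁ μ₂ h₁ h₂ U => ⟨hamiltonian_eq h₁ h₂ U, fun hU =>
    ⟨fun f hf z => canonicalBracket_comp_hamiltonian h₁ h₂ hU hf z, fun J γ hγ t ht f hf => ?_⟩⟩⟩
  · obtain ⟨e₁, e₂, e₃, e₄, e₅⟩ := reducedBracket_coordinates
    exact ⟨e₁, e₂, e₃, e₄, e₅, isCasimir_normSq⟩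
  -- A test function on `P` pulls back to a smooth test function on `T*Q`, and its bracket with the
  -- Hamiltonian descends.
  · have h := hγ t ht (f ∘ reduceMap) (hf.comp contMDiff_reduceMap)
    rw [canonicalBracket_comp_hamiltonian h₁ h₂ hU hf] at h
    exact h
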